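/- **Setting.** Let $D\ge 1$ and let $\Lambda=\{0,\dots,L-1\}^D$ with the periodic Manhattan distance $d(\mathbf r,\mathbf r')=\sum_i\min(|r_i-r_i'|,L-|r_i-r_i'|)$. Put one fermionic mode $c_{\mathbf r}$ on each site, with Majoranas $\gamma^1_{\mathbf r}=c_{\mathbf r}^\dagger+c_{\mathbf r}$ and $\gamma^2_{\mathbf r}=i(c^\dagger_{\mathbf r}-c_{\mathbf r})$. The fermions are encoded in $n$ qubits by a local encoding: a map $V$ that is isometric on the encoded states (all of Fock space, or one fermion-parity sector), such that every bilinear $\gamma^\alpha_{\mathbf r}\gamma^\beta_{\mathbf r'}$ of distinct Majoranas acts on the encoded states as a Pauli string (up to a phase) of weight at most $\varphi_0+d(\mathbf r,\mathbf r')$. A circuit of depth $d$ consists of layers $U_1,\dots,U_d$. Each layer is a product of unitary parity-preserving (not necessarily Gaussian) gates on pairwise disjoint regions of diameter at most $\ell$. On the qubits, every gate is implemented by a unitary which is a polynomial in the Pauli strings encoding the Majorana bilinears of its region, and which acts on the encoded states as the gate. The single-qubit Pauli noise of rate $p\in[0,2/3]$ is $T_p(\rho)=(1-\tfrac34p)\rho+\tfrac34p(\alpha_xX\rho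 X+\alpha_yY\rho Y+\alpha_zZ\rho Z)$ with $\alpha_x,\alpha_y,\alpha_z\ge 0$ and $\alpha_x+\alpha_y+\alpha_z=1$, and $\mathcal N_p=T_p^{\otimes n}$. In the noisy evolution the encoded initial state undergoes each layer followed by $\mathcal N_p$. The observable is $O=i\sum_{\mathbf r,\mathbf r',\alpha,\beta}O^{\alpha,\beta}_{\mathbf r,\mathbf r'}\gamma^\alpha_{\mathbf r}\gamma^\beta_{\mathbf r'}$, measured on the qubits through the Pauli strings of the bilinears, where the coefficient matrix $\widetilde O$ is real and antisymmetric with trace norm $\|\widetilde O\|_1\le 1$. **Proposition 3.** Let $\mu>D$, $K\ge 0$, and let $\varphi_0,\ell$ be natural numbers. There are a function $f$, continuous on $[0,2/3]$ with $\lim_{p\to0^+}f(p)=0$ and, as $p\to 0^+$, $$f(p)=\begin{cases}\mathcal O(p^{\mu-D}) & D<\mu<D+1,\\ \mathcal O(p\log\frac1p) & \mu=D+1,\\ \mathcal O(p) & \mu>D+1,\end{cases}$$ and a constant $C>0$, both depending only on $D,\mu,K,\varphi_0,\ell$, such that the following holds for all $L$, $n$, all such encodings, circuits of any depth $d$, noise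 parameters $p,\alpha_x,\alpha_y,\alpha_z$, observables $O$ as above, and initial fermionic states $\rho_0$ supported on the encoded states. If $$|\langle O_AO_B\rangle_{\rho_0}|\le\|O_A\|\,\|O_B\|\,\frac{K}{d(A,B)^\mu}$$ for all odd operators $O_A,O_B$ (linear combinations of products of an odd number of Majoranas) supported on disjoint nonempty regions $A,B\subseteq\Lambda$, then $$|\langle O\rangle_{\mathrm{noiseless}}-\langle O\rangle_{\mathrm{noisy}}|\le f(p)\,C\,d^{2D+1}.$$ In particular, for constant depth the error is bounded independently of the system size by a function of $p$ that vanishes as $p\to0$. -/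

import Mathlib

open Filter Topology Asymptotics
open scoped ComplexOrder

noncomputable section

namespace FermionNoise

/-! ### The lattice -/

/-- Sites of the `D`-dimensional lattice `{0, …, L-1}^D`. -/
abbrev Site (D L : ℕ) : Type := Fin D → Fin L

/-- Majorana labels `(r, α)`, where `α = 0, 1` stands for the two Majoranas of the site `r`. -/
abbrev Mode (D L : ℕ) : Type := Site D L × Fin 2

/-- Manhattan distance on the lattice with periodic boundary conditions. -/
def siteDist {D L : ℕ} (r s : Site D L) : ℕ :=
  ∑ i, min (Nat.dist (r i) (s i)) (L - Nat.dist (r i) (s i))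

/-- Distance between two (nonempty) regions: the smallest distance between their sites. -/
def regionDist {D L : ℕ} (A B : Finset (Site D L)) : ℕ :=
  sInf {m | ∃ r ∈ A, ∃ s ∈ B, m = siteDist r s}

/-! ### Fermions on the lattice -/

/-- The occupation-number basis of Fock space: a basis vector is the set of occupied sites. -/
abbrev Fock (D L : ℕ) : Type := Finset (Site D L)

/-- Operators on Fock space. -/
abbrev FermionOp (D L : ℕ) : Type := Matrix (Fock D L) (Fock D L) ℂ

/-- The annihilation operator `c_r`; the sign is the parity of the number of occupied sites that
precede `r` in a fixed enumeration of the sites. -/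
def annihilate {D L : ℕ} (r : Site D L) : FermionOp D L :=
  Matrix.of fun η ξ =>
    if r ∈ ξ ∧ η = ξ.erase r then
      (-1) ^ (ξ.filter fun s => finFunctionFinEquiv s < finFunctionFinEquiv r).card
    else 0

/-- The creation operator `c_r†`. -/
def create {D L : ℕ} (r : Site D L) : FermionOp D L := (annihilate r).conjTranspose

/-- The Majorana operators `γ_r^1 = c_r† + c_r` and `γ_r^2 = i (c_r† - c_r)`. -/
def majorana {D L : ℕ} (a : Mode D L) : FermionOp D L :=
  if a.2 = 0 then create a.1 + annihilate a.1
  else Complex.I • (create a.1 - annihilate a.1)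

/-- The fermion parity operator. -/
def parity (D L : ℕ) : FermionOp D L := Matrix.diagonal fun ξ => (-1) ^ ξ.card

/-- Linear combinations of products of an odd number of Majoranas located in `A`. -/
def oddOps {D L : ℕ} (A : Finset (Site D L)) : Submodule ℂ (FermionOp D L) :=
  Submodule.span ℂ
    {M | ∃ l : List (Mode D L), (∀ a ∈ l, a.1 ∈ A) ∧ Odd l.length ∧ M = (l.map majorana).prod}

/-- Linear combinations of products of an even number of Majoranas located in `A`. -/
def evenOps {D L : ℕ} (A : Finset (Site D L)) : Submodule ℂ (FermionOp D L) :=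
  Submodule.span ℂ
    {M | ∃ l : List (Mode D L), (∀ a ∈ l, a.1 ∈ A) ∧ Even l.length ∧ M = (l.map majorana).prod}

/-- The operator norm (with respect to the Euclidean norm on vectors). -/
def opNorm {ι : Type*} [Fintype ι] [DecidableEq ι] (A : Matrix ι ι ℂ) : ℝ :=
  ‖Matrix.toEuclideanCLM (𝕜 := ℂ) A‖

/-- The trace norm (Schatten 1-norm): the sum of the singular values. -/
def traceNorm {ι : Type*} [Fintype ι] [DecidableEq ι] (A : Matrix ι ι ℝ) : ℝ :=
  ∑ i, Real.sqrt ((Matrix.isHermitian_conjTranspose_mul_self A).eigenvalues i)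

/-- Density matrices. -/
def IsState {ι : Type*} [Fintype ι] (ρ : Matrix ι ι ℂ) : Prop :=
  ρ.PosSemidef ∧ ρ.trace = 1

/-- Power-law clustering of correlations between odd operators on disjoint regions. -/
def Clusters {D L : ℕ} (ρ : FermionOp D L) (K μ : ℝ) : Prop :=
  ∀ A B : Finset (Site D L), A.Nonempty → B.Nonempty → Disjoint A B →
    ∀ OA ∈ oddOps A, ∀ OB ∈ oddOps B,
      ‖(OA * OB * ρ).trace‖ ≤ opNorm OA * opNorm OB * (K / (regionDist A B : ℝ) ^ μ)

/-- The coefficient matrix of a normalized quadratic observable: real, antisymmetric, with trace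
norm at most one. -/
def IsQuadraticCoeff {D L : ℕ} (o : Matrix (Mode D L) (Mode D L) ℝ) : Prop :=
  o.transpose = -o ∧ traceNorm o ≤ 1

/-- The quadratic observable `i ∑ o_{ab} γ_a γ_b`. -/
def quadratic {D L : ℕ} (o : Matrix (Mode D L) (Mode D L) ℝ) : FermionOp D L :=
  Complex.I • ∑ a, ∑ b, (o a b : ℂ) • (majorana a * majorana b)

/-! ### Qubits and Pauli noise -/

/-- Operators on `n` qubits. -/
abbrev QubitOp (n : ℕ) : Type := Matrix (Fin n → Fin 2) (Fin n → Fin 2) ℂ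

/-- The matrices `1, X, Y, Z`. -/
def pauli : Fin 4 → Matrix (Fin 2) (Fin 2) ℂ :=
  ![1, !![0, 1; 1, 0], !![0, -Complex.I; Complex.I, 0], !![1, 0; 0, -1]]

/-- The tensor product of single-qubit operators. -/
def tensor {n : ℕ} (A : Fin n → Matrix (Fin 2) (Fin 2) ℂ) : QubitOp n :=
  Matrix.of fun x y => ∏ j, A j (x j) (y j)

/-- The Pauli string with the given letters. -/
def pauliString {n : ℕ} (s : Fin n → Fin 4) : QubitOp n := tensor fun j => pauli (s j)

/-- The number of qubits on which a Pauli string acts nontrivially. -/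
def weight {n : ℕ} (s : Fin n → Fin 4) : ℕ := (Finset.univ.filter fun j => s j ≠ 0).card

/-- The probabilities of `1, X, Y, Z` in the single-qubit Pauli channel of rate `p`. -/
def pauliProb (p αx αy αz : ℝ) : Fin 4 → ℝ :=
  ![1 - 3 / 4 * p, 3 / 4 * p * αx, 3 / 4 * p * αy, 3 / 4 * p * αz]

/-- The single-qubit Pauli channel `T_p`. -/
def singleNoise (p αx αy αz : ℝ) (ρ : Matrix (Fin 2) (Fin 2) ℂ) : Matrix (Fin 2) (Fin 2) ℂ :=
  ∑ k, (pauliProb p αx αy αz k : ℂ) • (pauli k * ρ * pauli k)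

/-- The channel that applies `T_p` to every qubit, as a mixture of Pauli strings. -/
def noise {n : ℕ} (p αx αy αz : ℝ) (ρ : QubitOp n) : QubitOp n :=
  ∑ s : Fin n → Fin 4, ((∏ j, pauliProb p αx αy αz (s j) : ℝ) : ℂ) •
    (pauliString s * ρ * pauliString s)

theorem tensor_mul {n : ℕ} (A B : Fin n → Matrix (Fin 2) (Fin 2) ℂ) :
    tensor A * tensor B = tensor fun j => A j * B j := by
  ext x y
  simp only [tensor, Matrix.mul_apply, Matrix.of_apply, ← Finset.prod_mul_distrib]
  rw [Finset.prod_univ_sum]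
  simp

/-- `noise` is the tensor power of the single-qubit channel. -/
theorem noise_tensor {n : ℕ} (p αx αy αz : ℝ) (A : Fin n → Matrix (Fin 2) (Fin 2) ℂ) :
    noise p αx αy αz (tensor A) = tensor fun j => singleNoise p αx αy αz (A j) := by
  ext x y
  simp only [noise, pauliString, tensor_mul, Matrix.sum_apply, Matrix.smul_apply]
  simp only [tensor, singleNoise, Matrix.of_apply, Matrix.sum_apply, Matrix.smul_apply,
    smul_eq_mul, Complex.ofReal_prod, ← Finset.prod_mul_distrib]
  rw [Finset.prod_univ_sum]
  simp

/-! ### Local encodings -/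

/-- A local encoding of the fermions into `n` qubits. The map `V` embeds the encoded states (all of
Fock space, or one of its two parity sectors) isometrically into the qubits, and every bilinear
`γ_a γ_b` of distinct Majoranas acts on the image as a Pauli string, up to a phase, whose weight is
at most `φ₀` plus the distance of the two sites. -/
structure LocalEncoding (D L n φ₀ : ℕ) where
  sector : FermionOp D L
  sector_eq : sector = 1 ∨ sector = (1 / 2 : ℂ) • (1 + parity D L) ∨
    sector = (1 / 2 : ℂ) • (1 - parity D L)
  V : Matrix (Fin n → Fin 2) (Fock D L) ℂ
  isometry : V.conjTranspose * V = sector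
  phase : Mode D L → Mode D L → ℂ
  phase_pow : ∀ a b, phase a b ^ 4 = 1
  string : Mode D L → Mode D L → Fin n → Fin 4
  intertwines : ∀ a b, a ≠ b →
    (phase a b • pauliString (string a b)) * V = V * (majorana a * majorana b)
  weight_le : ∀ a b, a ≠ b → weight (string a b) ≤ φ₀ + siteDist a.1 b.1

/-- The Pauli string, with its phase, that encodes `γ_a γ_b` for `a ≠ b`. -/
def LocalEncoding.bilinear {D L n φ₀ : ℕ} (E : LocalEncoding D L n φ₀) (a b : Mode D L) :
    QubitOp n :=
  E.phase a b • pauliString (E.string a b)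

/-- The encoded quadratic observable; its diagonal coefficients vanish by antisymmetry. -/
def LocalEncoding.quadratic {D L n φ₀ : ℕ} (E : LocalEncoding D L n φ₀)
    (o : Matrix (Mode D L) (Mode D L) ℝ) : QubitOp n :=
  Complex.I • ∑ a, ∑ b, (o a b : ℂ) • E.bilinear a b

/-- The encoded operators of a region: all polynomials in the Pauli strings that encode the
bilinears of the Majoranas in the region. -/
def LocalEncoding.regionAlgebra {D L n φ₀ : ℕ} (E : LocalEncoding D L n φ₀)
    (A : Finset (Site D L)) : Subalgebra ℂ (QubitOp n) :=
  Algebra.adjoin ℂ {M | ∃ a b : Mode D L, a.1 ∈ A ∧ b.1 ∈ A ∧ a ≠ b ∧ M = E.bilinear a b}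

/-! ### Circuits -/

/-- A parity-preserving gate on a region of diameter at most `ℓ`: a fermionic unitary that is an
even polynomial in the Majoranas of the region, together with the unitary implementing it on the
qubits, a polynomial in the Pauli strings that encode the Majorana bilinears of the region. -/
structure LocalGate {D L n φ₀ : ℕ} (E : LocalEncoding D L n φ₀) (ℓ : ℕ) where
  region : Finset (Site D L)
  diam_le : ∀ r ∈ region, ∀ s ∈ region, siteDist r s ≤ ℓ
  fermion : FermionOp D L
  fermion_unitary : fermion ∈ Matrix.unitaryGroup (Fock D L) ℂ
  fermion_even : fermion ∈ evenOps region
  qubit : QubitOp n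
  qubit_unitary : qubit ∈ Matrix.unitaryGroup (Fin n → Fin 2) ℂ
  qubit_mem : qubit ∈ E.regionAlgebra region
  intertwines : qubit * E.V = E.V * fermion

/-- A layer: gates acting on pairwise disjoint regions. -/
structure Layer {D L n φ₀ : ℕ} (E : LocalEncoding D L n φ₀) (ℓ : ℕ) where
  gates : List (LocalGate E ℓ)
  disjoint : gates.Pairwise fun g h => Disjoint g.region h.region

/-- The fermionic unitary of a layer. -/
def Layer.fermion {D L n φ₀ ℓ : ℕ} {E : LocalEncoding D L n φ₀} (l : Layer E ℓ) :
    FermionOp D L :=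
  (l.gates.map LocalGate.fermion).prod

/-- The qubit unitary of a layer. -/
def Layer.qubit {D L n φ₀ ℓ : ℕ} {E : LocalEncoding D L n φ₀} (l : Layer E ℓ) : QubitOp n :=
  (l.gates.map LocalGate.qubit).prod

/-- The noiseless evolution of a fermionic state; the head of the list is the first layer. -/
def idealState {D L n φ₀ ℓ : ℕ} {E : LocalEncoding D L n φ₀} (c : List (Layer E ℓ))
    (ρ : FermionOp D L) : FermionOp D L :=
  c.foldl (fun σ l => l.fermion * σ * l.fermion.conjTranspose) ρ

/-- The evolution of the encoded state on the qubits, with Pauli noise after each layer. -/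
def noisyState {D L n φ₀ ℓ : ℕ} {E : LocalEncoding D L n φ₀} (c : List (Layer E ℓ))
    (p αx αy αz : ℝ) (ρ : FermionOp D L) : QubitOp n :=
  c.foldl (fun σ l => noise p αx αy αz (l.qubit * σ * l.qubit.conjTranspose))
    (E.V * ρ * E.V.conjTranspose)

/-- The difference between the noiseless and the noisy expectation value of the quadratic
observable with coefficients `o`. -/
def measurementError {D L n φ₀ ℓ : ℕ} {E : LocalEncoding D L n φ₀} (c : List (Layer E ℓ))
    (p αx αy αz : ℝ) (ρ : FermionOp D L) (o : Matrix (Mode D L) (Mode D L) ℝ) : ℝ :=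
  ‖(quadratic o * idealState c ρ).trace -
    (E.quadratic o * noisyState c p αx αy αz ρ).trace‖

end FermionNoise

end

open FermionNoise

/-! The error is linear in the coefficient matrix: its modulus is that of a sum `∑ o a b * M a b`,
where `M a b` is the error of the single bilinear `γ_a γ_b`. A matrix with small absolute row and
column sums has small operator norm, so duality with the trace norm (`norm_sum_mul_le_traceNorm`)
reduces everything to a bound on `∑ b, |M a b|` that does not see the system size.

Let `r` be the distance of `a` and `b`, and `d` the depth. In the Heisenberg picture two mechanisms
control `M a b`. The first is a light cone: the noiseless evolution of the string of `γ_a γ_b` acts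
on at most `φ₀ + r + O(d^D)` qubits (`idealObs_mem_cone`), and a union bound charges `O(p)` per
qubit and layer (`norm_noisyObs_sub_idealObs_le`). This alone is not summable over `b`.

The second is decay. Without noise, a distant pair evolves into a product of two odd operators on
disjoint balls, and clustering gives `O(r^(-μ))`. With noise, a Pauli error may leave the encoded
states; but conjugation by a Pauli string only changes signs of the encoded bilinears, so it turns a
gate into another unitary of the same region algebra, which again acts as an even fermionic unitary.
Hence every error pattern still produces a product of two localized odd unitaries (`IsSpread`,
`IsSpread.conj_layer`), and the decay survives averaging.

For `r > 4dℓ` the two combine to `|M a b| ≲ r^(-μ) min(1, d p (r + d^D))` up to constants. A shell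
has `O(r^(D-1))` sites, which leaves `∑ r^(-(μ-D+1)) min(1, p r)`; the crossover at `r ≈ 1/p`
creates the three regimes of `f`. The `O(d^D)` remaining close partners cost `O(p d^(D+1))` each,
whence the power `d^(2D+1)`. -/

namespace FermionNoise

/-! ### Geometry of the lattice -/

/-- Distance on a cycle of length `L`. -/
def cycDist {L : ℕ} (x y : Fin L) : ℕ := min (Nat.dist x y) (L - Nat.dist x y)

theorem siteDist_eq {D L : ℕ} (r s : Site D L) : siteDist r s = ∑ i, cycDist (r i) (s i) := rfl

theorem cycDist_comm {L : ℕ} (x y : Fin L) : cycDist x y = cycDist y x := by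
  simp only [cycDist, Nat.dist_comm]

theorem cycDist_triangle {L : ℕ} (x y z : Fin L) :
    cycDist x z ≤ cycDist x y + cycDist y z := by
  have := x.2; have := y.2; have := z.2
  simp only [cycDist, Nat.dist]
  omega

theorem siteDist_self {D L : ℕ} (r : Site D L) : siteDist r r = 0 := by
  simp [siteDist]

theorem siteDist_comm {D L : ℕ} (r s : Site D L) : siteDist r s = siteDist s r := by
  simp only [siteDist_eq, cycDist_comm]

theorem siteDist_triangle {D L : ℕ} (r s t : Site D L) :
    siteDist r t ≤ siteDist r s + siteDist s t := by
  simp only [siteDist_eq, ← Finset.sum_add_distrib]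
  exact Finset.sum_le_sum fun i _ => cycDist_triangle _ _ _

/-- Closed ball around a site. -/
def siteBall {D L : ℕ} (r : Site D L) (m : ℕ) : Finset (Site D L) :=
  Finset.univ.filter fun s => siteDist r s ≤ m

/-- All sites within distance `m` of a region. -/
def thicken {D L : ℕ} (A : Finset (Site D L)) (m : ℕ) : Finset (Site D L) :=
  Finset.univ.filter fun s => ∃ r ∈ A, siteDist r s ≤ m

@[simp] theorem mem_siteBall {D L : ℕ} {r s : Site D L} {m : ℕ} :
    s ∈ siteBall r m ↔ siteDist r s ≤ m := by simp [siteBall]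

@[simp] theorem mem_thicken {D L : ℕ} {A : Finset (Site D L)} {s : Site D L} {m : ℕ} :
    s ∈ thicken A m ↔ ∃ r ∈ A, siteDist r s ≤ m := by simp [thicken]

theorem thicken_siteBall_subset {D L : ℕ} (r : Site D L) (m k : ℕ) :
    thicken (siteBall r m) k ⊆ siteBall r (m + k) := by
  intro s hs
  obtain ⟨t, ht, hts⟩ := mem_thicken.1 hs
  rw [mem_siteBall] at ht ⊢
  have := siteDist_triangle r t s
  omega

theorem thicken_union {D L : ℕ} (A B : Finset (Site D L)) (k : ℕ) :
    thicken (A ∪ B) k = thicken A k ∪ thicken B k := by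
  ext s
  simp only [mem_thicken, Finset.mem_union, or_and_right, exists_or]

theorem siteBall_subset {D L : ℕ} (r : Site D L) {m k : ℕ} (h : m ≤ k) :
    siteBall r m ⊆ siteBall r k := fun s hs => by
  rw [mem_siteBall] at hs ⊢; omega

theorem self_mem_siteBall {D L : ℕ} (r : Site D L) (m : ℕ) : r ∈ siteBall r m := by
  simp [siteDist_self]

theorem card_cycDist_le {L : ℕ} (x : Fin L) (m : ℕ) :
    (Finset.univ.filter fun y : Fin L => cycDist x y ≤ m).card ≤ 2 * m + 1 := by
  have := Finset.card_le_card_of_injOn (t := Finset.range (2 * m + 1))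
    (s := Finset.univ.filter fun y : Fin L => cycDist x y ≤ m)
    -- The injection is the signed offset from `x`, shifted by `m`; the branches select the
    -- representative among `y`, `y + L`, `y - L` within distance `m` of `x`.
    (fun y : Fin L => if (y : ℕ) ≤ x + m then (if (x : ℕ) ≤ y + m then y + m - x else y + m + L - x)
      else y + m - L - x) ?_ ?_
  · simpa using this
  · intro y hy
    have := x.2; have := y.2
    rw [Finset.mem_coe, Finset.mem_filter] at hy
    have hy := hy.2
    simp only [cycDist, Nat.dist] at hy
    rw [Finset.mem_coe, Finset.mem_range]
    dsimp only
    split_ifs <;> omega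
  · intro y hy z hz h
    have := x.2; have := y.2; have := z.2
    rw [Finset.mem_coe, Finset.mem_filter] at hy hz
    have hy := hy.2
    have hz := hz.2
    simp only [cycDist, Nat.dist] at hy hz
    ext
    dsimp only at h
    split_ifs at h <;> omega

theorem card_cycDist_eq {L : ℕ} (x : Fin L) (m : ℕ) :
    (Finset.univ.filter fun y : Fin L => cycDist x y = m).card ≤ 4 := by
  have := Finset.card_le_card_of_injOn
    -- These are the solutions `y` of `|x - y| = m` and of `L - |x - y| = m`.
    (t := ({(x : ℕ) + m, (x : ℕ) - m, (x : ℕ) + (L - m), (x : ℕ) - (L - m)} : Finset ℕ))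
    (s := Finset.univ.filter fun y : Fin L => cycDist x y = m)
    (fun y : Fin L => (y : ℕ)) ?_ ?_
  · exact this.trans Finset.card_le_four
  · intro y hy
    have := x.2; have := y.2
    rw [Finset.mem_coe, Finset.mem_filter] at hy
    have hy := hy.2
    simp only [cycDist, Nat.dist] at hy
    simp only [Finset.mem_coe, Finset.mem_insert, Finset.mem_singleton]
    omega
  · intro y _ z _ h
    exact Fin.ext h

theorem cycDist_le_siteDist {D L : ℕ} (r s : Site D L) (i : Fin D) :
    cycDist (r i) (s i) ≤ siteDist r s := by
  rw [siteDist_eq]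
  exact Finset.single_le_sum (f := fun i => cycDist (r i) (s i)) (fun _ _ => Nat.zero_le _)
    (Finset.mem_univ i)

theorem card_siteBall_le {D L : ℕ} (r : Site D L) (m : ℕ) :
    (siteBall r m).card ≤ (2 * m + 1) ^ D := by
  have hsub : siteBall r m ⊆
      Fintype.piFinset fun i => Finset.univ.filter fun y : Fin L => cycDist (r i) y ≤ m := by
    intro s hs
    rw [mem_siteBall] at hs
    simp only [Fintype.mem_piFinset, Finset.mem_filter, Finset.mem_univ, true_and]
    exact fun i => (cycDist_le_siteDist r s i).trans hs
  refine (Finset.card_le_card hsub).trans ?_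
  rw [Fintype.card_piFinset]
  refine (Finset.prod_le_pow_card _ _ _ fun i _ => card_cycDist_le (r i) m).trans ?_
  simp

/-- All coordinates but the first determine the cyclic distance of the first, hence that coordinate
up to four choices. The exponent `D - 1`, rather than the `D` of a ball, is what lets `μ > D`
suffice for summability. -/
theorem card_sphere_le {D L : ℕ} (hD : 1 ≤ D) (r : Site D L) (m : ℕ) :
    (Finset.univ.filter fun s => siteDist r s = m).card ≤ 4 * (2 * m + 1) ^ (D - 1) := by
  obtain ⟨D, rfl⟩ : ∃ k, D = k + 1 := ⟨D - 1, by omega⟩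
  have hsplit : ∀ s : Site (D + 1) L,
      siteDist r s = cycDist (r 0) (s 0) + siteDist (Fin.tail r) (Fin.tail s) := fun s => by
    rw [siteDist_eq, Fin.sum_univ_succ]; rfl
  refine (Finset.card_le_mul_card_image (f := fun s : Site (D + 1) L => (Fin.tail s : Site D L))
    _ 4 ?_).trans ?_
  · intro t _
    refine (Finset.card_le_card_of_injOn (t := Finset.univ.filter fun y : Fin L =>
      cycDist (r 0) y = m - siteDist (Fin.tail r) t) (fun s => s 0) ?_ ?_).trans
      (card_cycDist_eq (r 0) _)
    · intro s hs
      simp only [Finset.mem_coe, Finset.mem_filter, Finset.mem_univ, true_and] at hs ⊢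
      have := hsplit s
      rw [hs.2] at this
      omega
    · intro s hs s' hs' h
      simp only [Finset.mem_coe, Finset.mem_filter, Finset.mem_univ, true_and] at hs hs'
      rw [← Fin.cons_self_tail s, ← Fin.cons_self_tail s', hs.2, hs'.2]
      dsimp only at h
      rw [h]
  · rw [Nat.add_sub_cancel]
    refine Nat.mul_le_mul_left _ ((Finset.card_le_card ?_).trans
      (card_siteBall_le (Fin.tail r : Site D L) m))
    intro t ht
    obtain ⟨s, hs, rfl⟩ := Finset.mem_image.1 ht
    simp only [Finset.mem_filter, Finset.mem_univ, true_and] at hs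
    rw [mem_siteBall]
    have := hsplit s
    omega

/-- Summation over the sites in spherical shells. -/
theorem sum_far_le {D L : ℕ} (hD : 1 ≤ D) (r : Site D L) (g : ℕ → ℝ) (hg : ∀ m, 0 ≤ g m) :
    ∃ N : ℕ, ∑ s ∈ Finset.univ.filter (fun s => 1 ≤ siteDist r s), g (siteDist r s) ≤
      ∑ m ∈ Finset.Icc 1 N, (4 * (2 * m + 1) ^ (D - 1) : ℕ) * g m := by
  refine ⟨Finset.univ.sup (siteDist r), ?_⟩
  rw [← Finset.sum_fiberwise_of_maps_to (t := Finset.Icc 1 (Finset.univ.sup (siteDist r)))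
    (g := siteDist r)]
  · refine Finset.sum_le_sum fun m _ => ?_
    rw [Finset.sum_congr rfl (g := fun _ => g m), Finset.sum_const, nsmul_eq_mul]
    · refine mul_le_mul_of_nonneg_right ?_ (hg m)
      refine Nat.cast_le.2 ((Finset.card_le_card ?_).trans (card_sphere_le hD r m))
      intro s; simp
    · intro s hs
      rw [(Finset.mem_filter.1 hs).2]
  · intro s hs
    exact Finset.mem_Icc.2 ⟨(Finset.mem_filter.1 hs).2, Finset.le_sup (Finset.mem_univ s)⟩

theorem le_regionDist {D L : ℕ} {A B : Finset (Site D L)} (hA : A.Nonempty) (hB : B.Nonempty)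
    {m : ℕ} (h : ∀ r ∈ A, ∀ s ∈ B, m ≤ siteDist r s) : m ≤ regionDist A B := by
  obtain ⟨r, hr⟩ := hA
  obtain ⟨s, hs⟩ := hB
  refine le_csInf ⟨_, r, hr, s, hs, rfl⟩ ?_
  rintro _ ⟨r, hr, s, hs, rfl⟩
  exact h r hr s hs

theorem le_regionDist_siteBall {D L : ℕ} (r s : Site D L) (k : ℕ) :
    siteDist r s - 2 * k ≤ regionDist (siteBall r k) (siteBall s k) := by
  refine le_regionDist ⟨r, self_mem_siteBall r k⟩ ⟨s, self_mem_siteBall s k⟩ ?_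
  intro t ht u hu
  rw [mem_siteBall] at ht hu
  have h1 := siteDist_triangle r t s
  have h2 := siteDist_triangle t u s
  rw [siteDist_comm u s] at h2
  omega

theorem disjoint_siteBall {D L : ℕ} {r s : Site D L} {k : ℕ} (h : 2 * k < siteDist r s) :
    Disjoint (siteBall r k) (siteBall s k) := by
  rw [Finset.disjoint_left]
  intro t ht hu
  rw [mem_siteBall] at ht hu
  have h1 := siteDist_triangle r t s
  rw [siteDist_comm t s] at h1
  omega

/-! ### Majorana operators -/

/-- The sign that moves a fermion on site `s` past site `r`. -/
def exchangeSign {D L : ℕ} (r s : Site D L) : ℂ :=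
  if finFunctionFinEquiv s < finFunctionFinEquiv r then -1 else 1

/-- The Jordan-Wigner sign of site `r` in the configuration `ξ`. -/
def jordanWignerSign {D L : ℕ} (r : Site D L) (ξ : Fock D L) : ℂ := ∏ s ∈ ξ, exchangeSign r s

theorem exchangeSign_mul_self {D L : ℕ} (r s : Site D L) :
    exchangeSign r s * exchangeSign r s = 1 := by
  unfold exchangeSign; split_ifs <;> norm_num

theorem exchangeSign_self {D L : ℕ} (r : Site D L) : exchangeSign r r = 1 := by
  simp [exchangeSign]

theorem exchangeSign_swap {D L : ℕ} {r s : Site D L} (h : r ≠ s) :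
    exchangeSign r s = -exchangeSign s r := by
  unfold exchangeSign
  rcases lt_or_gt_of_ne (fun h' => h (finFunctionFinEquiv.injective h')) with h' | h'
  · simp [h', h'.not_gt]
  · simp [h', h'.not_gt]

theorem jordanWignerSign_eq {D L : ℕ} (r : Site D L) (ξ : Fock D L) :
    ((-1 : ℂ)) ^ (ξ.filter fun s => finFunctionFinEquiv s < finFunctionFinEquiv r).card =
      jordanWignerSign r ξ := by
  simp [jordanWignerSign, exchangeSign, Finset.prod_ite]

theorem jordanWignerSign_mul_self {D L : ℕ} (r : Site D L) (ξ : Fock D L) :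
    jordanWignerSign r ξ * jordanWignerSign r ξ = 1 := by
  rw [jordanWignerSign, ← Finset.prod_mul_distrib]
  simp [exchangeSign_mul_self]

theorem symmDiff_singleton_of_mem {D L : ℕ} {r : Site D L} {ξ : Fock D L} (h : r ∈ ξ) :
    symmDiff ξ {r} = ξ.erase r := by
  ext s; by_cases hs : s = r <;> simp [Finset.mem_symmDiff, hs, h]

theorem symmDiff_singleton_of_notMem {D L : ℕ} {r : Site D L} {ξ : Fock D L} (h : r ∉ ξ) :
    symmDiff ξ {r} = insert r ξ := by
  ext s; by_cases hs : s = r <;> simp [Finset.mem_symmDiff, hs, h]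

theorem jordanWignerSign_symmDiff {D L : ℕ} (r s : Site D L) (ξ : Fock D L) :
    jordanWignerSign r (symmDiff ξ {s}) = exchangeSign r s * jordanWignerSign r ξ := by
  by_cases h : s ∈ ξ
  · rw [symmDiff_singleton_of_mem h, jordanWignerSign, jordanWignerSign,
      ← Finset.mul_prod_erase ξ _ h, ← mul_assoc, exchangeSign_mul_self, one_mul]
  · rw [symmDiff_singleton_of_notMem h, jordanWignerSign, jordanWignerSign,
      Finset.prod_insert h]

/-- The phase of `γ_r^α` that does not come from the Jordan-Wigner string. -/
def localPhase {D L : ℕ} (a : Mode D L) (ξ : Fock D L) : ℂ :=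
  if a.2 = 0 then 1 else if a.1 ∈ ξ then -Complex.I else Complex.I

theorem annihilate_apply {D L : ℕ} (r : Site D L) (η ξ : Fock D L) :
    annihilate r η ξ = if r ∈ ξ ∧ η = symmDiff ξ {r} then jordanWignerSign r ξ else 0 := by
  rw [annihilate, Matrix.of_apply, jordanWignerSign_eq]
  by_cases h : r ∈ ξ
  · rw [symmDiff_singleton_of_mem h]
  · simp [h]

theorem star_jordanWignerSign {D L : ℕ} (r : Site D L) (ξ : Fock D L) :
    star (jordanWignerSign r ξ) = jordanWignerSign r ξ := by
  rw [← jordanWignerSign_eq]; simp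

theorem create_apply {D L : ℕ} (r : Site D L) (η ξ : Fock D L) :
    create r η ξ = if r ∉ ξ ∧ η = symmDiff ξ {r} then jordanWignerSign r ξ else 0 := by
  rw [create, Matrix.conjTranspose_apply, annihilate_apply]
  have key : (r ∈ η ∧ ξ = symmDiff η {r}) ↔ (r ∉ ξ ∧ η = symmDiff ξ {r}) := by
    constructor
    · rintro ⟨h, rfl⟩
      refine ⟨by simp [Finset.mem_symmDiff, h], ?_⟩
      rw [symmDiff_symmDiff_cancel_right]
    · rintro ⟨h, rfl⟩
      refine ⟨by simp [Finset.mem_symmDiff, h], ?_⟩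
      rw [symmDiff_symmDiff_cancel_right]
  by_cases h : r ∉ ξ ∧ η = symmDiff ξ {r}
  · rw [if_pos h, if_pos (key.2 h), star_jordanWignerSign, h.2, jordanWignerSign_symmDiff,
      exchangeSign_self, one_mul]
  · rw [if_neg h, if_neg (fun h' => h (key.1 h')), star_zero]

/-- A Majorana is a monomial matrix that flips the occupation of one site, so the Clifford relations
become identities between phases. -/
theorem majorana_apply {D L : ℕ} (a : Mode D L) (η ξ : Fock D L) :
    majorana a η ξ = if η = symmDiff ξ {a.1} then jordanWignerSign a.1 ξ * localPhase a ξ else 0 := by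
  unfold majorana localPhase
  by_cases ha : a.2 = 0
  · simp only [ha, if_true, Matrix.add_apply, create_apply, annihilate_apply]
    by_cases h : a.1 ∈ ξ <;> simp [h]
  · simp only [ha, if_false, Matrix.smul_apply, Matrix.sub_apply, create_apply, annihilate_apply]
    by_cases h : a.1 ∈ ξ <;> by_cases h' : η = symmDiff ξ {a.1} <;> simp [h, h', mul_comm]

theorem majorana_conjTranspose {D L : ℕ} (a : Mode D L) :
    (majorana a).conjTranspose = majorana a := by
  unfold majorana create
  split_ifs
  · rw [Matrix.conjTranspose_add, Matrix.conjTranspose_conjTranspose, add_comm]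
  · rw [Matrix.conjTranspose_smul, Matrix.conjTranspose_sub, Matrix.conjTranspose_conjTranspose]
    simp only [RCLike.star_def, Complex.conj_I, neg_smul, smul_sub]
    abel

theorem majorana_mul_apply {D L : ℕ} (a b : Mode D L) (η ξ : Fock D L) :
    (majorana a * majorana b) η ξ = if η = symmDiff (symmDiff ξ {b.1}) {a.1} then
      jordanWignerSign a.1 (symmDiff ξ {b.1}) * localPhase a (symmDiff ξ {b.1}) *
        (jordanWignerSign b.1 ξ * localPhase b ξ) else 0 := by
  rw [Matrix.mul_apply, Finset.sum_eq_single (symmDiff ξ {b.1})]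
  · rw [majorana_apply, majorana_apply, if_pos rfl, ite_mul, zero_mul]
  · intro ζ _ h
    rw [majorana_apply b, if_neg h, mul_zero]
  · simp

theorem localPhase_symmDiff {D L : ℕ} {a : Mode D L} {s : Site D L} (h : a.1 ≠ s) (ξ : Fock D L) :
    localPhase a (symmDiff ξ {s}) = localPhase a ξ := by
  simp [localPhase, Finset.mem_symmDiff, h]

theorem localPhase_symmDiff_self {D L : ℕ} (a : Mode D L) (ξ : Fock D L) :
    localPhase a (symmDiff ξ {a.1}) * localPhase a ξ = 1 := by
  unfold localPhase
  by_cases h : a.2 = 0 <;> by_cases h' : a.1 ∈ ξ <;> simp [Finset.mem_symmDiff, h, h']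

theorem majorana_mul_self {D L : ℕ} (a : Mode D L) : majorana a * majorana a = 1 := by
  ext η ξ
  rw [majorana_mul_apply, symmDiff_symmDiff_cancel_right, Matrix.one_apply]
  refine if_congr Iff.rfl ?_ rfl
  rw [mul_mul_mul_comm, localPhase_symmDiff_self, jordanWignerSign_symmDiff, exchangeSign_self,
    one_mul, jordanWignerSign_mul_self, one_mul]

theorem majorana_anticomm {D L : ℕ} {a b : Mode D L} (h : a ≠ b) :
    majorana a * majorana b = -(majorana b * majorana a) := by
  ext η ξ
  rw [Matrix.neg_apply, majorana_mul_apply, majorana_mul_apply, symmDiff_right_comm]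
  by_cases hη : η = symmDiff (symmDiff ξ {a.1}) {b.1}
  swap
  · simp [hη]
  rw [if_pos hη, if_pos hη]
  -- On a common site the Jordan-Wigner signs agree and the minus sign comes from the local phases;
  -- on different sites it comes from `exchangeSign_swap`.
  by_cases hr : a.1 = b.1
  · obtain ⟨r, α⟩ := a
    obtain ⟨s, β⟩ := b
    obtain rfl : r = s := hr
    have hαβ : α ≠ β := fun h' => h (by rw [h'])
    simp only [jordanWignerSign_symmDiff, exchangeSign_self]
    have : (α = 0 ∧ β = 1) ∨ (α = 1 ∧ β = 0) := by omega
    rcases this with ⟨rfl, rfl⟩ | ⟨rfl, rfl⟩ <;> by_cases hm : r ∈ ξ <;>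
      simp [localPhase, Finset.mem_symmDiff, hm] <;> ring
  · rw [localPhase_symmDiff hr, localPhase_symmDiff (Ne.symm hr), jordanWignerSign_symmDiff,
      jordanWignerSign_symmDiff, exchangeSign_swap hr]
    ring

theorem neg_one_pow_card_symmDiff {D L : ℕ} (r : Site D L) (ξ : Fock D L) :
    ((-1 : ℂ)) ^ (symmDiff ξ {r}).card = -(-1) ^ ξ.card := by
  by_cases h : r ∈ ξ
  · rw [symmDiff_singleton_of_mem h, ← Finset.card_erase_add_one h, pow_succ]
    simp
  · rw [symmDiff_singleton_of_notMem h, Finset.card_insert_of_notMem h, pow_succ]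
    simp

theorem majorana_mul_parity {D L : ℕ} (a : Mode D L) :
    majorana a * parity D L = -(parity D L * majorana a) := by
  ext η ξ
  rw [parity, Matrix.neg_apply, Matrix.mul_diagonal, Matrix.diagonal_mul, majorana_apply]
  split_ifs with h
  · rw [h, neg_one_pow_card_symmDiff]; ring
  · simp

/-! ### Even and odd operators -/

/-- An ordered product of Majoranas. -/
def majoranaWord {D L : ℕ} (l : List (Mode D L)) : FermionOp D L := (l.map majorana).prod

theorem majorana_mul_word {D L : ℕ} (a : Mode D L) (l : List (Mode D L)) (h : ∀ b ∈ l, a ≠ b) :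
    majorana a * majoranaWord l = (-1 : ℂ) ^ l.length • (majoranaWord l * majorana a) := by
  induction l with
  | nil => simp [majoranaWord]
  | cons b l ih =>
    have h1 : majoranaWord (b :: l) = majorana b * majoranaWord l := by simp [majoranaWord]
    rw [h1, ← mul_assoc, majorana_anticomm (h b (by simp)), neg_mul, mul_assoc,
      ih fun c hc => h c (by simp [hc]), List.length_cons, pow_succ, mul_smul_comm, mul_assoc]
    simp

theorem word_mul_word {D L : ℕ} (l m : List (Mode D L)) (h : ∀ a ∈ l, ∀ b ∈ m, a ≠ b) :
    majoranaWord l * majoranaWord m =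
      (-1 : ℂ) ^ (l.length * m.length) • (majoranaWord m * majoranaWord l) := by
  induction l with
  | nil => simp [majoranaWord]
  | cons b l ih =>
    have h1 : majoranaWord (b :: l) = majorana b * majoranaWord l := by simp [majoranaWord]
    rw [h1, mul_assoc, ih fun a ha => h a (by simp [ha]), mul_smul_comm, ← mul_assoc,
      majorana_mul_word b m (h b (by simp)), smul_mul_assoc, smul_smul, ← pow_add, mul_assoc,
      List.length_cons, Nat.succ_mul]

theorem word_mul_parity {D L : ℕ} (l : List (Mode D L)) :
    majoranaWord l * parity D L = (-1 : ℂ) ^ l.length • (parity D L * majoranaWord l) := by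
  induction l with
  | nil => simp [majoranaWord]
  | cons b l ih =>
    have h1 : majoranaWord (b :: l) = majorana b * majoranaWord l := by simp [majoranaWord]
    rw [h1, mul_assoc, ih, mul_smul_comm, ← mul_assoc, majorana_mul_parity, List.length_cons,
      pow_succ]
    simp [mul_assoc]

theorem word_conjTranspose {D L : ℕ} (l : List (Mode D L)) :
    (majoranaWord l).conjTranspose = majoranaWord l.reverse := by
  rw [majoranaWord, majoranaWord, Matrix.conjTranspose_list_prod, List.map_map, List.map_reverse]
  congr 2
  exact List.map_congr_left fun a _ => majorana_conjTranspose a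

theorem mul_mem_span_of_mul_mem {R : Type*} [Ring R] [Algebra ℂ R] {S T U : Set R}
    (h : ∀ s ∈ S, ∀ t ∈ T, s * t ∈ U) {M N : R} (hM : M ∈ Submodule.span ℂ S)
    (hN : N ∈ Submodule.span ℂ T) : M * N ∈ Submodule.span ℂ U := by
  have h1 := Submodule.mul_mem_mul hM hN
  rw [Submodule.span_mul_span] at h1
  refine Submodule.span_mono ?_ h1
  rintro _ ⟨s, hs, t, ht, rfl⟩
  exact h s hs t ht

theorem conjTranspose_mem_span {ι : Type*} [Fintype ι] {S : Set (Matrix ι ι ℂ)}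
    (h : ∀ s ∈ S, s.conjTranspose ∈ S) {M : Matrix ι ι ℂ} (hM : M ∈ Submodule.span ℂ S) :
    M.conjTranspose ∈ Submodule.span ℂ S := by
  induction hM using Submodule.span_induction with
  | mem x hx => exact Submodule.subset_span (h x hx)
  | zero => simp
  | add x y _ _ hx hy => rw [Matrix.conjTranspose_add]; exact add_mem hx hy
  | smul c x _ hx => rw [Matrix.conjTranspose_smul]; exact Submodule.smul_mem _ _ hx

theorem commute_of_mem_span {R : Type*} [Ring R] [Algebra ℂ R] {S T : Set R}
    (h : ∀ s ∈ S, ∀ t ∈ T, s * t = t * s) {M N : R} (hM : M ∈ Submodule.span ℂ S)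
    (hN : N ∈ Submodule.span ℂ T) : M * N = N * M := by
  induction hM using Submodule.span_induction with
  | mem x hx =>
    induction hN using Submodule.span_induction with
    | mem y hy => exact h x hx y hy
    | zero => simp
    | add y z _ _ hy hz => rw [mul_add, add_mul, hy, hz]
    | smul c y _ hy => rw [mul_smul_comm, smul_mul_assoc, hy]
  | zero => simp
  | add y z _ _ hy hz => rw [mul_add, add_mul, hy, hz]
  | smul c y _ hy => rw [mul_smul_comm, smul_mul_assoc, hy]

theorem evenOps_mono {D L : ℕ} {A B : Finset (Site D L)} (h : A ⊆ B) : evenOps A ≤ evenOps B :=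
  Submodule.span_mono fun _ ⟨l, hl, hl', hM⟩ => ⟨l, fun a ha => h (hl a ha), hl', hM⟩

theorem oddOps_mono {D L : ℕ} {A B : Finset (Site D L)} (h : A ⊆ B) : oddOps A ≤ oddOps B :=
  Submodule.span_mono fun _ ⟨l, hl, hl', hM⟩ => ⟨l, fun a ha => h (hl a ha), hl', hM⟩

theorem one_mem_evenOps {D L : ℕ} (A : Finset (Site D L)) : 1 ∈ evenOps A :=
  Submodule.subset_span ⟨[], by simp, by simp, by simp⟩

theorem majorana_mem_oddOps {D L : ℕ} {A : Finset (Site D L)} {a : Mode D L} (h : a.1 ∈ A) :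
    majorana a ∈ oddOps A :=
  Submodule.subset_span ⟨[a], by simpa using h, by simp, by simp⟩

theorem majorana_mul_mem_evenOps {D L : ℕ} {A : Finset (Site D L)} {a b : Mode D L}
    (ha : a.1 ∈ A) (hb : b.1 ∈ A) : majorana a * majorana b ∈ evenOps A :=
  Submodule.subset_span ⟨[a, b], by simpa using ⟨ha, hb⟩, by simp, by simp⟩

theorem even_mul_even {D L : ℕ} {A : Finset (Site D L)} {M N : FermionOp D L}
    (hM : M ∈ evenOps A) (hN : N ∈ evenOps A) : M * N ∈ evenOps A := by
  refine mul_mem_span_of_mul_mem ?_ hM hN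
  rintro _ ⟨l, hl, hl', rfl⟩ _ ⟨m, hm, hm', rfl⟩
  refine ⟨l ++ m, ?_, by rw [List.length_append]; exact hl'.add hm', by simp⟩
  intro a ha
  exact (List.mem_append.1 ha).elim (hl a) (hm a)

theorem even_mul_odd {D L : ℕ} {A : Finset (Site D L)} {M N : FermionOp D L}
    (hM : M ∈ evenOps A) (hN : N ∈ oddOps A) : M * N ∈ oddOps A := by
  refine mul_mem_span_of_mul_mem ?_ hM hN
  rintro _ ⟨l, hl, hl', rfl⟩ _ ⟨m, hm, hm', rfl⟩
  refine ⟨l ++ m, ?_, by rw [List.length_append]; exact hl'.add_odd hm', by simp⟩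
  intro a ha
  exact (List.mem_append.1 ha).elim (hl a) (hm a)

theorem odd_mul_even {D L : ℕ} {A : Finset (Site D L)} {M N : FermionOp D L}
    (hM : M ∈ oddOps A) (hN : N ∈ evenOps A) : M * N ∈ oddOps A := by
  refine mul_mem_span_of_mul_mem ?_ hM hN
  rintro _ ⟨l, hl, hl', rfl⟩ _ ⟨m, hm, hm', rfl⟩
  refine ⟨l ++ m, ?_, by rw [List.length_append]; exact hl'.add_even hm', by simp⟩
  intro a ha
  exact (List.mem_append.1 ha).elim (hl a) (hm a)

theorem conjTranspose_mem_evenOps {D L : ℕ} {A : Finset (Site D L)} {M : FermionOp D L}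
    (hM : M ∈ evenOps A) : M.conjTranspose ∈ evenOps A := by
  refine conjTranspose_mem_span ?_ hM
  rintro _ ⟨l, hl, hl', rfl⟩
  exact ⟨l.reverse, by simpa using hl, by simpa using hl', word_conjTranspose l⟩

theorem even_commute_odd {D L : ℕ} {A B : Finset (Site D L)} (h : Disjoint A B)
    {M N : FermionOp D L} (hM : M ∈ evenOps A) (hN : N ∈ oddOps B) : M * N = N * M := by
  refine commute_of_mem_span ?_ hM hN
  rintro _ ⟨l, hl, hl', rfl⟩ _ ⟨m, hm, hm', rfl⟩
  have := word_mul_word l m fun a ha b hb hab =>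
    Finset.disjoint_left.1 h (hl a ha) (hab ▸ hm b hb)
  rwa [(hl'.mul_right _).neg_one_pow, one_smul] at this

theorem even_commute_parity {D L : ℕ} {A : Finset (Site D L)} {M : FermionOp D L}
    (hM : M ∈ evenOps A) : M * parity D L = parity D L * M := by
  refine commute_of_mem_span (T := {parity D L}) ?_ hM (Submodule.subset_span rfl)
  rintro _ ⟨l, hl, hl', rfl⟩ _ rfl
  have := word_mul_parity l
  rwa [hl'.neg_one_pow, one_smul] at this

theorem opNorm_le_one {ι : Type*} [Fintype ι] [DecidableEq ι] {U : Matrix ι ι ℂ}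
    (h : U.conjTranspose * U = 1) : opNorm U ≤ 1 := by
  have h1 : star (Matrix.toEuclideanCLM (𝕜 := ℂ) U) * Matrix.toEuclideanCLM (𝕜 := ℂ) U = 1 := by
    rw [← map_star, ← map_mul, Matrix.star_eq_conjTranspose, h, map_one]
  have h2 := CStarRing.norm_star_mul_self (x := Matrix.toEuclideanCLM (𝕜 := ℂ) U)
  rw [h1] at h2
  have h3 : ‖(1 : EuclideanSpace ℂ ι →L[ℂ] EuclideanSpace ℂ ι)‖ ≤ 1 :=
    ContinuousLinearMap.norm_id_le
  unfold opNorm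
  nlinarith [norm_nonneg (Matrix.toEuclideanCLM (𝕜 := ℂ) U)]

theorem opNorm_nonneg {ι : Type*} [Fintype ι] [DecidableEq ι] (U : Matrix ι ι ℂ) :
    0 ≤ opNorm U := norm_nonneg _

/-! ### Pauli strings -/

/-- The sign in the commutation relation of two Pauli matrices. -/
noncomputable def pauliSign (k l : Fin 4) : ℂ := if k = 0 ∨ l = 0 ∨ k = l then 1 else -1

theorem pauli_mul_pauli (k l : Fin 4) :
    pauli k * pauli l = pauliSign k l • (pauli l * pauli k) := by
  fin_cases k <;> fin_cases l <;> ext i j <;> fin_cases i <;> fin_cases j <;>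
    simp [pauli, pauliSign, Matrix.mul_apply, Fin.sum_univ_two]

theorem pauli_mul_self (k : Fin 4) : pauli k * pauli k = 1 := by
  fin_cases k <;> ext i j <;> fin_cases i <;> fin_cases j <;>
    simp [pauli, Matrix.mul_apply, Fin.sum_univ_two]

theorem pauli_conjTranspose (k : Fin 4) : (pauli k).conjTranspose = pauli k := by
  fin_cases k <;> ext i j <;> fin_cases i <;> fin_cases j <;> simp [pauli]

theorem tensor_one {n : ℕ} : tensor (fun _ : Fin n => (1 : Matrix (Fin 2) (Fin 2) ℂ)) = 1 := by
  ext x y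
  simp only [tensor, Matrix.of_apply, Matrix.one_apply, Finset.prod_ite_zero, Finset.prod_const_one]
  simp [funext_iff]

theorem tensor_smul {n : ℕ} (e : Fin n → ℂ) (A : Fin n → Matrix (Fin 2) (Fin 2) ℂ) :
    tensor (fun j => e j • A j) = (∏ j, e j) • tensor A := by
  ext x y
  simp [tensor, Finset.prod_mul_distrib]

theorem pauliString_mul_self {n : ℕ} (s : Fin n → Fin 4) : pauliString s * pauliString s = 1 := by
  rw [pauliString, tensor_mul]
  simp only [pauli_mul_self, tensor_one]

theorem pauliString_conjTranspose {n : ℕ} (s : Fin n → Fin 4) :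
    (pauliString s).conjTranspose = pauliString s := by
  ext x y
  simp only [pauliString, tensor, Matrix.conjTranspose_apply, Matrix.of_apply, star_prod]
  refine Finset.prod_congr rfl fun j _ => ?_
  rw [← Matrix.conjTranspose_apply, pauli_conjTranspose]

theorem pauliString_comm_or {n : ℕ} (s t : Fin n → Fin 4) :
    pauliString s * pauliString t = pauliString t * pauliString s ∨
      pauliString s * pauliString t = -(pauliString t * pauliString s) := by
  have h : pauliString s * pauliString t =
      (∏ j, pauliSign (s j) (t j)) • (pauliString t * pauliString s) := by
    rw [pauliString, pauliString, tensor_mul, tensor_mul, ← tensor_smul]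
    simp only [← pauli_mul_pauli]
  have h1 : ∀ F : Finset (Fin n), ∏ j ∈ F, pauliSign (s j) (t j) = 1 ∨
      ∏ j ∈ F, pauliSign (s j) (t j) = -1 := by
    intro F
    induction F using Finset.induction_on with
    | empty => simp
    | insert j F hj ih =>
      rw [Finset.prod_insert hj]
      have : pauliSign (s j) (t j) = 1 ∨ pauliSign (s j) (t j) = -1 := by
        unfold pauliSign; split_ifs <;> simp
      rcases this with h | h <;> rcases ih with h' | h' <;> simp [h, h']
  rcases h1 Finset.univ with h2 | h2
  · left; rw [h, h2, one_smul]
  · right; rw [h, h2, neg_smul, one_smul]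

theorem pauliString_commute_of_disjoint {n : ℕ} {s t : Fin n → Fin 4}
    (h : ∀ j, t j ≠ 0 → s j = 0) : pauliString s * pauliString t = pauliString t * pauliString s := by
  rw [pauliString, pauliString, tensor_mul, tensor_mul]
  congr 1
  funext j
  by_cases ht : t j = 0
  · simp [ht, pauli]
  · simp [h j ht, pauli]

/-- Unitaries that map every Pauli string to itself up to a sign. -/
structure IsPauliLike {n : ℕ} (W : QubitOp n) : Prop where
  unitary : W.conjTranspose * W = 1
  conj_string : ∀ t, W * pauliString t * W.conjTranspose = pauliString t ∨
    W * pauliString t * W.conjTranspose = -pauliString t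

theorem isPauliLike_one {n : ℕ} : IsPauliLike (1 : QubitOp n) :=
  ⟨by simp, fun t => by simp⟩

theorem isPauliLike_pauliString {n : ℕ} (s : Fin n → Fin 4) : IsPauliLike (pauliString s) := by
  refine ⟨by rw [pauliString_conjTranspose, pauliString_mul_self], fun t => ?_⟩
  rw [pauliString_conjTranspose]
  rcases pauliString_comm_or s t with h | h
  · left; rw [h, mul_assoc, pauliString_mul_self, mul_one]
  · right; rw [h, neg_mul, mul_assoc, pauliString_mul_self, mul_one]

theorem IsPauliLike.mul {n : ℕ} {W W' : QubitOp n} (h : IsPauliLike W) (h' : IsPauliLike W') :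
    IsPauliLike (W * W') := by
  refine ⟨?_, fun t => ?_⟩
  · rw [Matrix.conjTranspose_mul, mul_assoc, ← mul_assoc _ W, h.unitary, one_mul, h'.unitary]
  · have : W * W' * pauliString t * (W * W').conjTranspose =
        W * (W' * pauliString t * W'.conjTranspose) * W.conjTranspose := by
      rw [Matrix.conjTranspose_mul]; simp only [mul_assoc]
    rw [this]
    rcases h'.conj_string t with h1 | h1 <;> rw [h1]
    · exact h.conj_string t
    · rw [mul_neg, neg_mul]
      rcases h.conj_string t with h2 | h2 <;> simp [h2]

/-! ### Pauli noise -/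

/-- The probability of an error pattern. -/
noncomputable def patternProb {n : ℕ} (p αx αy αz : ℝ) (s : Fin n → Fin 4) : ℝ :=
  ∏ j, pauliProb p αx αy αz (s j)

/-- The parameters of a single-qubit Pauli channel. -/
structure NoiseParams (p αx αy αz : ℝ) : Prop where
  p_nonneg : 0 ≤ p
  p_le : p ≤ 2 / 3
  x_nonneg : 0 ≤ αx
  y_nonneg : 0 ≤ αy
  z_nonneg : 0 ≤ αz
  sum_eq : αx + αy + αz = 1

section Noise

variable {p αx αy αz : ℝ} {n : ℕ}

theorem NoiseParams.pauliProb_nonneg (h : NoiseParams p αx αy αz) (k : Fin 4) :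
    0 ≤ pauliProb p αx αy αz k := by
  obtain ⟨h1, h2, h3, h4, h5, -⟩ := h
  fin_cases k <;> simp only [pauliProb, Fin.zero_eta, Fin.mk_one, Fin.reduceFinMk,
    Matrix.cons_val] <;> first | linarith | positivity

theorem NoiseParams.sum_pauliProb (h : NoiseParams p αx αy αz) :
    ∑ k, pauliProb p αx αy αz k = 1 := by
  simp only [pauliProb, Fin.sum_univ_four, Matrix.cons_val]
  linear_combination (3 / 4 * p) * h.sum_eq

theorem NoiseParams.sum_pauliProb_ne (h : NoiseParams p αx αy αz) :
    ∑ k, (if k ≠ 0 then pauliProb p αx αy αz k else 0) = 3 / 4 * p := by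
  simp only [pauliProb, Fin.sum_univ_four, Matrix.cons_val]
  simp
  linear_combination (3 / 4 * p) * h.sum_eq

theorem NoiseParams.patternProb_nonneg (h : NoiseParams p αx αy αz) (s : Fin n → Fin 4) :
    0 ≤ patternProb p αx αy αz s := Finset.prod_nonneg fun _ _ => h.pauliProb_nonneg _

theorem NoiseParams.sum_patternProb (h : NoiseParams p αx αy αz) :
    ∑ s : Fin n → Fin 4, patternProb p αx αy αz s = 1 := by
  have := Finset.prod_univ_sum (fun _ : Fin n => (Finset.univ : Finset (Fin 4)))
    (fun _ k => pauliProb p αx αy αz k)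
  rw [Fintype.piFinset_univ] at this
  simp only [patternProb, ← this, h.sum_pauliProb, Finset.prod_const_one]

theorem NoiseParams.sum_patternProb_error_at (h : NoiseParams p αx αy αz) (j : Fin n) :
    ∑ s : Fin n → Fin 4, (if s j ≠ 0 then patternProb p αx αy αz s else 0) = 3 / 4 * p := by
  have := Finset.prod_univ_sum (fun _ : Fin n => (Finset.univ : Finset (Fin 4)))
    (fun i k => if i = j then (if k ≠ 0 then pauliProb p αx αy αz k else 0)
      else pauliProb p αx αy αz k)
  rw [Fintype.piFinset_univ, ← Finset.mul_prod_erase _ _ (Finset.mem_univ j)] at this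
  simp only [if_true] at this
  rw [h.sum_pauliProb_ne, Finset.prod_eq_one, mul_one] at this
  · rw [this]
    refine Finset.sum_congr rfl fun s _ => ?_
    rw [← Finset.mul_prod_erase _ _ (Finset.mem_univ j), patternProb, if_pos rfl,
      ← Finset.mul_prod_erase _ (fun i => pauliProb p αx αy αz (s i)) (Finset.mem_univ j)]
    split_ifs
    · congr 1
      exact Finset.prod_congr rfl fun i hi => by rw [if_neg (Finset.ne_of_mem_erase hi)]
    · simp
  · intro i hi
    simp only [if_neg (Finset.ne_of_mem_erase hi), h.sum_pauliProb]

theorem NoiseParams.sum_patternProb_error_on (h : NoiseParams p αx αy αz) (R : Finset (Fin n)) :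
    ∑ s : Fin n → Fin 4, (if ∃ j ∈ R, s j ≠ 0 then patternProb p αx αy αz s else 0) ≤
      R.card * (3 / 4 * p) := by
  calc ∑ s : Fin n → Fin 4, (if ∃ j ∈ R, s j ≠ 0 then patternProb p αx αy αz s else 0)
      ≤ ∑ s : Fin n → Fin 4, ∑ j ∈ R, (if s j ≠ 0 then patternProb p αx αy αz s else 0) := by
        refine Finset.sum_le_sum fun s _ => ?_
        have h0 : ∀ j ∈ R, 0 ≤ (if s j ≠ 0 then patternProb p αx αy αz s else 0) := fun j _ => by
          split_ifs
          · exact h.patternProb_nonneg s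
          · rfl
        split_ifs with hs
        · obtain ⟨j, hj, hs⟩ := hs
          refine le_trans ?_ (Finset.single_le_sum h0 hj)
          rw [if_pos hs]
        · exact Finset.sum_nonneg h0
    _ = R.card * (3 / 4 * p) := by
        rw [Finset.sum_comm, Finset.sum_congr rfl fun j _ => h.sum_patternProb_error_at j,
          Finset.sum_const, nsmul_eq_mul]

/-- The noise channel is self-adjoint for the trace pairing. -/
theorem trace_mul_noise (Y σ : QubitOp n) :
    (Y * noise p αx αy αz σ).trace = (noise p αx αy αz Y * σ).trace := by
  simp only [noise, Finset.mul_sum, Finset.sum_mul, Matrix.trace_sum, mul_smul_comm,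
    smul_mul_assoc, Matrix.trace_smul]
  refine Finset.sum_congr rfl fun s _ => ?_
  congr 1
  rw [← mul_assoc, Matrix.trace_mul_comm]
  simp only [mul_assoc]

/-- Conjugation `Z ↦ Uᴴ Z U`. -/
noncomputable def conjBy (U : QubitOp n) : QubitOp n →ₗ[ℂ] QubitOp n :=
  (LinearMap.mulLeft ℂ U.conjTranspose).comp (LinearMap.mulRight ℂ U)

theorem conjBy_apply (U Z : QubitOp n) : conjBy U Z = U.conjTranspose * Z * U := by
  simp [conjBy, mul_assoc]

theorem map_noise (φ : QubitOp n →ₗ[ℂ] ℂ) (Z : QubitOp n) :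
    φ (noise p αx αy αz Z) =
      ∑ s, (patternProb p αx αy αz s : ℂ) * φ (conjBy (pauliString s) Z) := by
  simp only [noise, map_sum, map_smul, smul_eq_mul, conjBy_apply, pauliString_conjTranspose,
    patternProb]

/-- The noise is a convex combination of conjugations by Pauli strings, so a bound valid for each
error pattern passes to the average. -/
theorem NoiseParams.norm_map_noise_le (h : NoiseParams p αx αy αz) (φ : QubitOp n →ₗ[ℂ] ℂ)
    (Z : QubitOp n) {κ : ℝ} (hκ : ∀ s, ‖φ (conjBy (pauliString s) Z)‖ ≤ κ) :
    ‖φ (noise p αx αy αz Z)‖ ≤ κ := by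
  rw [map_noise]
  calc ‖∑ s, (patternProb p αx αy αz s : ℂ) * φ (conjBy (pauliString s) Z)‖
      ≤ ∑ s, patternProb p αx αy αz s * κ := by
        refine norm_sum_le_of_le _ fun s _ => ?_
        rw [norm_mul, Complex.norm_real, Real.norm_of_nonneg (h.patternProb_nonneg s)]
        exact mul_le_mul_of_nonneg_left (hκ s) (h.patternProb_nonneg s)
    _ = κ := by rw [← Finset.sum_mul, h.sum_patternProb, one_mul]

/-- An operator that is invariant under all error patterns which are trivial on `R` is changed
little by the noise. -/
theorem NoiseParams.norm_map_noise_sub_le (h : NoiseParams p αx αy αz) (φ : QubitOp n →ₗ[ℂ] ℂ)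
    (Z : QubitOp n) (R : Finset (Fin n)) {κ : ℝ} (hκ : ∀ s, ‖φ (conjBy (pauliString s) Z)‖ ≤ κ)
    (hZ : ‖φ Z‖ ≤ κ)
    (hR : ∀ s : Fin n → Fin 4, (∀ j ∈ R, s j = 0) → conjBy (pauliString s) Z = Z) :
    ‖φ (noise p αx αy αz Z) - φ Z‖ ≤ 2 * κ * (R.card * (3 / 4 * p)) := by
  have hκ0 : 0 ≤ κ := (norm_nonneg _).trans hZ
  have h1 : φ (noise p αx αy αz Z) - φ Z = ∑ s, (patternProb p αx αy αz s : ℂ) *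
      (φ (conjBy (pauliString s) Z) - φ Z) := by
    simp only [mul_sub, Finset.sum_sub_distrib, ← map_noise, ← Finset.sum_mul]
    rw [← Complex.ofReal_sum, h.sum_patternProb, Complex.ofReal_one, one_mul]
  rw [h1]
  -- Only patterns that hit `R` contribute, each at most `2κ`; their total probability is then
  -- estimated by a union bound over `R`.
  calc _ ≤ ∑ s : Fin n → Fin 4,
        2 * κ * (if ∃ j ∈ R, s j ≠ 0 then patternProb p αx αy αz s else 0) := by
        refine norm_sum_le_of_le _ fun s _ => ?_
        rw [norm_mul, Complex.norm_real, Real.norm_of_nonneg (h.patternProb_nonneg s)]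
        split_ifs with hs
        · rw [mul_comm]
          refine mul_le_mul_of_nonneg_right ?_ (h.patternProb_nonneg s)
          exact (norm_sub_le _ _).trans (by linarith [hκ s])
        · push Not at hs
          rw [hR s hs]; simp
    _ ≤ _ := by
        rw [← Finset.mul_sum]
        exact mul_le_mul_of_nonneg_left (h.sum_patternProb_error_on R) (by positivity)

end Noise

/-! ### Evolution of observables -/

section Heisenberg

variable {D L n φ₀ ℓ : ℕ} {E : LocalEncoding D L n φ₀} {p αx αy αz : ℝ}

/-- The noiseless evolution of a qubit observable. -/
noncomputable def idealObs : List (Layer E ℓ) → QubitOp n → QubitOp n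
  | [], Y => Y
  | l :: c, Y => conjBy l.qubit (idealObs c Y)

/-- The noisy evolution of a qubit observable. -/
noncomputable def noisyObs (p αx αy αz : ℝ) : List (Layer E ℓ) → QubitOp n → QubitOp n
  | [], Y => Y
  | l :: c, Y => conjBy l.qubit (noise p αx αy αz (noisyObs p αx αy αz c Y))

theorem trace_noisyObs (c : List (Layer E ℓ)) (Y σ : QubitOp n) :
    (Y * c.foldl (fun σ l => noise p αx αy αz (l.qubit * σ * l.qubit.conjTranspose)) σ).trace =
      (noisyObs p αx αy αz c Y * σ).trace := by
  induction c generalizing σ with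
  | nil => rfl
  | cons l c ih =>
    rw [List.foldl_cons, ih, trace_mul_noise, noisyObs, conjBy_apply, ← mul_assoc,
      Matrix.trace_mul_comm]
    simp only [mul_assoc]

/-- Comparison of the noisy and the noiseless evolution of an observable, in terms of classes of
operators that are stable under Pauli errors and under the layers of the circuit. -/
theorem norm_noisyObs_sub_idealObs_le (hp : NoiseParams p αx αy αz) (S : ℕ → Set (QubitOp n))
    (hS : ∀ k, ∀ Z ∈ S k, ∀ s, conjBy (pauliString s) Z ∈ S k)
    (hU : ∀ k, ∀ Z ∈ S k, ∀ l : Layer E ℓ, conjBy l.qubit Z ∈ S (k + 1))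
    {Y : QubitOp n} (hY : Y ∈ S 0) (R : Finset (Fin n)) (d : ℕ)
    (hR : ∀ c : List (Layer E ℓ), c.length ≤ d → ∀ s : Fin n → Fin 4, (∀ j ∈ R, s j = 0) →
      conjBy (pauliString s) (idealObs c Y) = idealObs c Y)
    (c : List (Layer E ℓ)) (hc : c.length ≤ d) (φ : QubitOp n →ₗ[ℂ] ℂ) (κ : ℝ)
    (hφ : ∀ Z ∈ S c.length, ‖φ Z‖ ≤ κ) :
    ‖φ (noisyObs p αx αy αz c Y) - φ (idealObs c Y)‖ ≤
      2 * κ * min 1 (c.length * (R.card * (3 / 4 * p))) := by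
  have hideal : ∀ c : List (Layer E ℓ), idealObs c Y ∈ S c.length := fun c => by
    induction c with
    | nil => exact hY
    | cons l c ih => exact hU _ _ ih l
  -- The functional varies in the induction: the outermost layer and its error pattern are absorbed
  -- into it, and the stability of the classes `S k` preserves the bound `κ`.
  have hnoisy : ∀ (c : List (Layer E ℓ)) (φ : QubitOp n →ₗ[ℂ] ℂ),
      (∀ Z ∈ S c.length, ‖φ Z‖ ≤ κ) → ‖φ (noisyObs p αx αy αz c Y)‖ ≤ κ := fun c => by
    induction c with
    | nil => exact fun φ hφ => hφ _ hY
    | cons l c ih =>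
      intro φ hφ
      refine hp.norm_map_noise_le (φ.comp (conjBy l.qubit)) _ fun s => ?_
      exact ih (φ.comp ((conjBy l.qubit).comp (conjBy (pauliString s)))) fun Z hZ =>
        hφ _ (hU _ _ (hS _ _ hZ s) l)
  have hdiff : ∀ (c : List (Layer E ℓ)), c.length ≤ d → ∀ φ : QubitOp n →ₗ[ℂ] ℂ,
      (∀ Z ∈ S c.length, ‖φ Z‖ ≤ κ) → ‖φ (noisyObs p αx αy αz c Y) - φ (idealObs c Y)‖ ≤
      2 * κ * (c.length * (R.card * (3 / 4 * p))) := fun c => by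
    induction c with
    | nil => intro _ φ hφ; simp [noisyObs, idealObs]
    | cons l c ih =>
      intro hc φ hφ
      have hc' : c.length ≤ d := by simp at hc; omega
      -- Telescoping: the first term is the error accumulated so far, averaged over the new pattern;
      -- the second is one noise step on an ideal observable, which is insensitive to errors off
      -- `R`.
      have h1 : φ (noisyObs p αx αy αz (l :: c) Y) - φ (idealObs (l :: c) Y) =
          (φ.comp (conjBy l.qubit)) (noise p αx αy αz (noisyObs p αx αy αz c Y - idealObs c Y)) +
          ((φ.comp (conjBy l.qubit)) (noise p αx αy αz (idealObs c Y)) -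
            (φ.comp (conjBy l.qubit)) (idealObs c Y)) := by
        have h2 : noise p αx αy αz (noisyObs p αx αy αz c Y - idealObs c Y) =
            noise p αx αy αz (noisyObs p αx αy αz c Y) - noise p αx αy αz (idealObs c Y) := by
          simp only [noise, mul_sub, sub_mul, smul_sub, Finset.sum_sub_distrib]
        rw [h2, map_sub]
        simp only [noisyObs, idealObs, LinearMap.comp_apply]
        ring
      rw [h1]
      refine (norm_add_le _ _).trans ?_
      have h3 := hp.norm_map_noise_le (φ.comp (conjBy l.qubit))
        (noisyObs p αx αy αz c Y - idealObs c Y)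
        (κ := 2 * κ * (c.length * (R.card * (3 / 4 * p)))) fun s => by
          rw [map_sub, map_sub]
          exact ih hc' (φ.comp ((conjBy l.qubit).comp (conjBy (pauliString s)))) fun Z hZ =>
            hφ _ (hU _ _ (hS _ _ hZ s) l)
      have h4 := hp.norm_map_noise_sub_le (φ.comp (conjBy l.qubit)) (idealObs c Y) R (κ := κ)
        (fun s => hφ _ (hU _ _ (hS _ _ (hideal c) s) l)) (hφ _ (hU _ _ (hideal c) l))
        (hR c hc')
      refine (add_le_add h3 h4).trans (le_of_eq ?_)
      rw [List.length_cons]; push_cast; ring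
  have hκ0 : 0 ≤ κ := (norm_nonneg _).trans (hφ _ (hideal c))
  rw [mul_min_of_nonneg _ _ (by positivity)]
  refine le_min ?_ (hdiff c hc φ hφ)
  refine (norm_sub_le _ _).trans ?_
  linarith [hnoisy c φ hφ, hφ _ (hideal c)]

end Heisenberg

/-! ### Light cones -/

/-- A property of operators and regions that is enlarged by the gates touching the region, and
whose operators commute with all other gates, spreads by at most the diameter of the gates. -/
theorem lightcone {D L : ℕ} {ι γ : Type*} [Fintype ι] [DecidableEq ι]
    (Pr : Finset (Site D L) → Matrix ι ι ℂ → Prop) (ℓ : ℕ) (reg : γ → Finset (Site D L))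
    (U : γ → Matrix ι ι ℂ) (gs : List γ)
    (hdiam : ∀ g ∈ gs, ∀ r ∈ reg g, ∀ s ∈ reg g, siteDist r s ≤ ℓ)
    (hdisj : gs.Pairwise fun g h => Disjoint (reg g) (reg h))
    (hmono : ∀ A B Y, A ⊆ B → Pr A Y → Pr B Y)
    (hstep : ∀ g ∈ gs, ∀ A Y, Pr A Y → Pr (A ∪ reg g) ((U g).conjTranspose * Y * U g))
    (hcomm : ∀ g ∈ gs, ∀ A Y, Disjoint A (reg g) → Pr A Y → (U g).conjTranspose * Y * U g = Y)
    (A : Finset (Site D L)) (Y : Matrix ι ι ℂ) (hY : Pr A Y) :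
    Pr (thicken A ℓ) ((gs.map U).prod.conjTranspose * Y * (gs.map U).prod) := by
  -- The gates are treated one at a time. The invariant says that the part of `A'` added so far is
  -- disjoint from the remaining gates, so a later gate can only matter by touching the original
  -- `A`. Hence a whole layer enlarges `A` by `ℓ` only once.
  suffices H : ∀ A' Y, A' ⊆ thicken A ℓ → (∀ g ∈ gs, Disjoint (reg g) (A' \ A)) → Pr A' Y →
      Pr (thicken A ℓ) ((gs.map U).prod.conjTranspose * Y * (gs.map U).prod) by
    refine H A Y (fun r hr => mem_thicken.2 ⟨r, hr, by simp [siteDist_self]⟩) ?_ hY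
    simp
  induction gs with
  | nil => intro A' Y hA' _ hY; simpa using hmono _ _ _ hA' hY
  | cons g gs ih =>
    intro A' Y hA' hd hY
    rw [List.pairwise_cons] at hdisj
    have h1 : ((g :: gs).map U).prod.conjTranspose * Y * ((g :: gs).map U).prod =
        (gs.map U).prod.conjTranspose * ((U g).conjTranspose * Y * U g) * (gs.map U).prod := by
      rw [List.map_cons, List.prod_cons, Matrix.conjTranspose_mul]
      simp only [mul_assoc]
    rw [h1]
    have ih := ih (fun h hh => hdiam h (by simp [hh])) hdisj.2
      (fun h hh => hstep h (by simp [hh])) (fun h hh => hcomm h (by simp [hh]))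
    have hdg := hd g (by simp)
    by_cases hA : Disjoint A (reg g)
    · rw [hcomm g (by simp) A' Y ?_ hY]
      · exact ih A' Y hA' (fun h hh => hd h (by simp [hh])) hY
      · rw [Finset.disjoint_left] at hA hdg ⊢
        intro r hr hr'
        by_cases hrA : r ∈ A
        · exact hA hrA hr'
        · exact hdg hr' (Finset.mem_sdiff.2 ⟨hr, hrA⟩)
    · obtain ⟨r, hr, hr'⟩ := Finset.not_disjoint_iff.1 hA
      refine ih (A' ∪ reg g) _ ?_ ?_ (hstep g (by simp) A' Y hY)
      · refine Finset.union_subset hA' fun s hs => ?_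
        exact mem_thicken.2 ⟨r, hr, hdiam g (by simp) r hr' s hs⟩
      · intro h hh
        rw [Finset.union_sdiff_distrib, Finset.disjoint_union_right]
        exact ⟨hd h (by simp [hh]), ((hdisj.1 h hh).symm).mono_right Finset.sdiff_subset⟩

/-! ### Generated algebras -/

section Adjoin

variable {ι : Type*} [Fintype ι] [DecidableEq ι] {S : Set (Matrix ι ι ℂ)}

theorem conjTranspose_mem_adjoin (h : ∀ g ∈ S, g.conjTranspose ∈ Algebra.adjoin ℂ S)
    {x : Matrix ι ι ℂ} (hx : x ∈ Algebra.adjoin ℂ S) : x.conjTranspose ∈ Algebra.adjoin ℂ S := by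
  induction hx using Algebra.adjoin_induction with
  | mem x hx => exact h x hx
  | algebraMap r =>
    rw [Algebra.algebraMap_eq_smul_one, Matrix.conjTranspose_smul, Matrix.conjTranspose_one]
    exact Subalgebra.smul_mem _ (one_mem _) _
  | add x y _ _ hx hy => rw [Matrix.conjTranspose_add]; exact add_mem hx hy
  | mul x y _ _ hx hy => rw [Matrix.conjTranspose_mul]; exact mul_mem hy hx

theorem conj_mem_adjoin {W : Matrix ι ι ℂ} (hW : W.conjTranspose * W = 1)
    (h : ∀ g ∈ S, W * g * W.conjTranspose ∈ Algebra.adjoin ℂ S)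
    {x : Matrix ι ι ℂ} (hx : x ∈ Algebra.adjoin ℂ S) :
    W * x * W.conjTranspose ∈ Algebra.adjoin ℂ S := by
  have hW' : W * W.conjTranspose = 1 := mul_eq_one_comm.1 hW
  induction hx using Algebra.adjoin_induction with
  | mem x hx => exact h x hx
  | algebraMap r =>
    rw [Algebra.algebraMap_eq_smul_one, mul_smul_comm, smul_mul_assoc, mul_one, hW']
    exact Subalgebra.smul_mem _ (one_mem _) _
  | add x y _ _ hx hy => rw [mul_add, add_mul]; exact add_mem hx hy
  | mul x y _ _ hx hy =>
    have : W * (x * y) * W.conjTranspose =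
        (W * x * W.conjTranspose) * (W * y * W.conjTranspose) := by
      calc _ = W * x * 1 * y * W.conjTranspose := by simp only [mul_assoc, one_mul]
        _ = _ := by rw [← hW]; simp only [mul_assoc]
    rw [this]; exact mul_mem hx hy

theorem commute_of_mem_adjoin {T : Matrix ι ι ℂ} (h : ∀ g ∈ S, g * T = T * g)
    {x : Matrix ι ι ℂ} (hx : x ∈ Algebra.adjoin ℂ S) : x * T = T * x := by
  induction hx using Algebra.adjoin_induction with
  | mem x hx => exact h x hx
  | algebraMap r => exact Algebra.commutes r T
  | add x y _ _ hx hy => rw [mul_add, add_mul, hx, hy]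
  | mul x y _ _ hx hy => rw [mul_assoc, hy, ← mul_assoc, hx, mul_assoc]

end Adjoin

/-! ### Encoded operators -/

namespace LocalEncoding

variable {D L n φ₀ : ℕ} (E : LocalEncoding D L n φ₀)

theorem star_phase_mul (a b : Mode D L) : star (E.phase a b) * E.phase a b = 1 := by
  have h : ‖E.phase a b‖ = 1 := Complex.norm_eq_one_of_pow_eq_one (E.phase_pow a b) (by norm_num)
  rw [RCLike.star_def, Complex.conj_mul', h]
  simp

theorem bilinear_unitary (a b : Mode D L) :
    (E.bilinear a b).conjTranspose * E.bilinear a b = 1 := by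
  rw [bilinear, Matrix.conjTranspose_smul, pauliString_conjTranspose, smul_mul_smul_comm,
    pauliString_mul_self, star_phase_mul, one_smul]

theorem bilinear_conjTranspose (a b : Mode D L) :
    ∃ z : ℂ, (E.bilinear a b).conjTranspose = z • E.bilinear a b := by
  refine ⟨star (E.phase a b) * star (E.phase a b), ?_⟩
  rw [bilinear, Matrix.conjTranspose_smul, pauliString_conjTranspose, smul_smul, mul_assoc,
    star_phase_mul, mul_one]

theorem bilinear_mul_V {a b : Mode D L} (h : a ≠ b) :
    E.bilinear a b * E.V = E.V * (majorana a * majorana b) := E.intertwines a b h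

theorem conj_bilinear {W : QubitOp n} (hW : IsPauliLike W) (a b : Mode D L) :
    W * E.bilinear a b * W.conjTranspose = E.bilinear a b ∨
      W * E.bilinear a b * W.conjTranspose = -E.bilinear a b := by
  simp only [bilinear, mul_smul_comm, smul_mul_assoc]
  rcases hW.conj_string (E.string a b) with h | h <;> simp [h]

/-- Pauli strings commute or anticommute. On the range of `V` the products commute because the
Majorana pairs are disjoint; anticommutation would thus make a unitary annihilate `V`. Commutation
therefore holds on all qubit states, including those outside the encoded ones. -/
theorem bilinear_commute (hV : E.V ≠ 0) {a b c d : Mode D L} (hab : a ≠ b) (hcd : c ≠ d)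
    (hac : a ≠ c) (had : a ≠ d) (hbc : b ≠ c) (hbd : b ≠ d) :
    E.bilinear a b * E.bilinear c d = E.bilinear c d * E.bilinear a b := by
  rcases pauliString_comm_or (E.string a b) (E.string c d) with h | h
  · simp only [bilinear, smul_mul_smul_comm, h, mul_comm]
  · exfalso
    have h1 : E.bilinear a b * E.bilinear c d = -(E.bilinear c d * E.bilinear a b) := by
      simp only [bilinear, smul_mul_smul_comm, h, mul_comm, smul_neg]
    have h2 : E.bilinear a b * E.bilinear c d * E.V =
        E.V * (majoranaWord [a, b] * majoranaWord [c, d]) := by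
      rw [Matrix.mul_assoc, E.bilinear_mul_V hcd, ← Matrix.mul_assoc,
        E.bilinear_mul_V hab, Matrix.mul_assoc]
      simp [majoranaWord]
    have h3 : E.bilinear c d * E.bilinear a b * E.V =
        E.V * (majoranaWord [c, d] * majoranaWord [a, b]) := by
      rw [Matrix.mul_assoc, E.bilinear_mul_V hab, ← Matrix.mul_assoc,
        E.bilinear_mul_V hcd, Matrix.mul_assoc]
      simp [majoranaWord]
    have h4 : majoranaWord [a, b] * majoranaWord [c, d] =
        majoranaWord [c, d] * majoranaWord [a, b] := by
      rw [word_mul_word]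
      · norm_num
      · simp [hac, had, hbc, hbd]
    rw [h4, ← h3, h1, Matrix.neg_mul, neg_eq_iff_add_eq_zero, ← two_smul ℂ,
      smul_eq_zero_iff_right two_ne_zero] at h2
    apply hV
    calc E.V = ((E.bilinear a b).conjTranspose * (((E.bilinear c d).conjTranspose *
          E.bilinear c d) * E.bilinear a b)) * E.V := by
          rw [bilinear_unitary, one_mul, bilinear_unitary, Matrix.one_mul]
      _ = ((E.bilinear a b).conjTranspose * (E.bilinear c d).conjTranspose) *
          (E.bilinear c d * E.bilinear a b * E.V) := by simp only [Matrix.mul_assoc]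
      _ = 0 := by rw [h2, Matrix.mul_zero]

theorem conj_mem_regionAlgebra {W : QubitOp n} (hW : IsPauliLike W) {A : Finset (Site D L)}
    {q : QubitOp n} (hq : q ∈ E.regionAlgebra A) :
    W * q * W.conjTranspose ∈ E.regionAlgebra A := by
  refine conj_mem_adjoin hW.unitary ?_ hq
  rintro _ ⟨a, b, ha, hb, hab, rfl⟩
  have h : E.bilinear a b ∈ E.regionAlgebra A :=
    Algebra.subset_adjoin ⟨a, b, ha, hb, hab, rfl⟩
  rcases E.conj_bilinear hW a b with h' | h' <;> rw [h']
  · exact h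
  · exact neg_mem h

theorem exists_even_lift {A : Finset (Site D L)} {q : QubitOp n} (hq : q ∈ E.regionAlgebra A) :
    ∃ F ∈ evenOps A, q * E.V = E.V * F := by
  induction hq using Algebra.adjoin_induction with
  | mem x hx =>
    obtain ⟨a, b, ha, hb, hab, rfl⟩ := hx
    exact ⟨_, majorana_mul_mem_evenOps ha hb, E.bilinear_mul_V hab⟩
  | algebraMap r =>
    refine ⟨r • 1, Submodule.smul_mem _ _ (one_mem_evenOps A), ?_⟩
    rw [Algebra.algebraMap_eq_smul_one, Matrix.smul_mul, Matrix.mul_smul, Matrix.one_mul,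
      Matrix.mul_one]
  | add x y _ _ hx hy =>
    obtain ⟨F, hF, hxF⟩ := hx
    obtain ⟨G, hG, hyG⟩ := hy
    exact ⟨F + G, add_mem hF hG, by rw [Matrix.add_mul, Matrix.mul_add, hxF, hyG]⟩
  | mul x y _ _ hx hy =>
    obtain ⟨F, hF, hxF⟩ := hx
    obtain ⟨G, hG, hyG⟩ := hy
    refine ⟨F * G, even_mul_even hF hG, ?_⟩
    rw [Matrix.mul_assoc, hyG, ← Matrix.mul_assoc, hxF, Matrix.mul_assoc]

theorem sector_commute {A : Finset (Site D L)} {F : FermionOp D L} (hF : F ∈ evenOps A) :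
    E.sector * F = F * E.sector := by
  have h := even_commute_parity hF
  rcases E.sector_eq with h' | h' | h' <;> rw [h']
  · simp
  · simp [add_mul, mul_add, h]
  · simp [sub_mul, mul_sub, h]

/-- A Majorana on a site outside `A` commutes with the even operator `X` but exchanges the parity
sectors, so if `X` vanishes on one sector, it vanishes on the other. -/
theorem eq_zero_of_mul_sector {A : Finset (Site D L)} {r : Site D L} (hr : r ∉ A)
    {X : FermionOp D L} (hX : X ∈ evenOps A) (h : X * E.sector = 0) : X = 0 := by
  set g : FermionOp D L := majorana (r, 0)
  have hg : g * g = 1 := majorana_mul_self _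
  have hXg : X * g = g * X := even_commute_odd (B := {r}) (by simpa using hr) hX
    (majorana_mem_oddOps (by simp))
  have hP : g * (X * parity D L) * g = -(X * parity D L) := by
    rw [← mul_assoc, ← hXg, mul_assoc, mul_assoc, ← mul_assoc g,
      show g * parity D L = -(parity D L * g) from majorana_mul_parity _, neg_mul, mul_assoc, hg,
      mul_one, mul_neg]
  have hX1 : g * X * g = X := by rw [← hXg, mul_assoc, hg, mul_one]
  rcases E.sector_eq with h' | h' | h' <;> rw [h'] at h
  · simpa using h
  · rw [mul_smul_comm, smul_eq_zero_iff_right (by norm_num), mul_add, mul_one] at h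
    have h2 : g * (X + X * parity D L) * g = 0 := by rw [h]; simp
    rw [mul_add, add_mul, hP, hX1] at h2
    have h3 : (2 : ℂ) • X = 0 := by
      calc (2 : ℂ) • X = (X + X * parity D L) + (X + -(X * parity D L)) := by rw [two_smul]; abel
        _ = 0 := by rw [h, h2, add_zero]
    exact (smul_eq_zero_iff_right two_ne_zero).1 h3
  · rw [mul_smul_comm, smul_eq_zero_iff_right (by norm_num), mul_sub, mul_one] at h
    have h2 : g * (X - X * parity D L) * g = 0 := by rw [h]; simp
    rw [mul_sub, sub_mul, hP, hX1] at h2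
    have h3 : (2 : ℂ) • X = 0 := by
      calc (2 : ℂ) • X = (X - X * parity D L) + (X - -(X * parity D L)) := by rw [two_smul]; abel
        _ = 0 := by rw [h, h2, add_zero]
    exact (smul_eq_zero_iff_right two_ne_zero).1 h3

theorem exists_unitary_lift {A : Finset (Site D L)} {r : Site D L} (hr : r ∉ A) {q : QubitOp n}
    (hq : q ∈ E.regionAlgebra A) (hu : q.conjTranspose * q = 1) :
    ∃ F ∈ evenOps A, F.conjTranspose * F = 1 ∧ q * E.V = E.V * F := by
  obtain ⟨F, hF, hqF⟩ := E.exists_even_lift hq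
  refine ⟨F, hF, ?_, hqF⟩
  rw [← sub_eq_zero]
  refine E.eq_zero_of_mul_sector hr
    (sub_mem (even_mul_even (conjTranspose_mem_evenOps hF) hF) (one_mem_evenOps A)) ?_
  -- With `P` the sector projection, `Fᴴ F P = Fᴴ P F = (V F)ᴴ (V F) = (q V)ᴴ (q V) = Vᴴ V = P`. The
  -- spare site `r` upgrades this to unitarity on all of Fock space, which the operator norm bound
  -- in the clustering hypothesis needs.
  rw [sub_mul, one_mul, sub_eq_zero, mul_assoc, ← E.sector_commute hF, ← E.isometry,
    Matrix.mul_assoc E.V.conjTranspose, ← hqF, ← Matrix.mul_assoc, ← Matrix.conjTranspose_mul,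
    ← hqF, Matrix.conjTranspose_mul, Matrix.mul_assoc, ← Matrix.mul_assoc q.conjTranspose, hu,
    Matrix.one_mul]

theorem conjTranspose_mul_V {q : QubitOp n} {F : FermionOp D L} (hq : q.conjTranspose * q = 1)
    (hF : F.conjTranspose * F = 1) (h : q * E.V = E.V * F) :
    q.conjTranspose * E.V = E.V * F.conjTranspose := by
  calc q.conjTranspose * E.V = q.conjTranspose * (E.V * F) * F.conjTranspose := by
        rw [Matrix.mul_assoc, Matrix.mul_assoc E.V, mul_eq_one_comm.1 hF, Matrix.mul_one]
    _ = E.V * F.conjTranspose := by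
        rw [← h, ← Matrix.mul_assoc, hq, Matrix.one_mul]

/-! ### Operators that act like a product of two localized odd operators -/

/-- Up to any Pauli error, `Y` acts on the encoded states as a product of odd fermionic unitaries
in the regions `A` and `B`. -/
def IsSpread (A B : Finset (Site D L)) (Y : QubitOp n) : Prop :=
  ∀ W, IsPauliLike W → ∃ OA ∈ oddOps A, ∃ OB ∈ oddOps B, OA.conjTranspose * OA = 1 ∧
    OB.conjTranspose * OB = 1 ∧ W * Y * W.conjTranspose * E.V = E.V * (OA * OB)

theorem isSpread_bilinear {a b : Mode D L} (h : a ≠ b) {A B : Finset (Site D L)} (ha : a.1 ∈ A)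
    (hb : b.1 ∈ B) : E.IsSpread A B (E.bilinear a b) := by
  intro W hW
  have h1 : ∀ c : Mode D L, (majorana c).conjTranspose * majorana c = 1 := fun c => by
    rw [majorana_conjTranspose, majorana_mul_self]
  rcases E.conj_bilinear hW a b with h' | h'
  · exact ⟨_, majorana_mem_oddOps ha, _, majorana_mem_oddOps hb, h1 a, h1 b,
      by rw [h', E.bilinear_mul_V h]⟩
  · exact ⟨_, neg_mem (majorana_mem_oddOps ha), _, majorana_mem_oddOps hb,
      by rw [Matrix.conjTranspose_neg, neg_mul_neg, h1 a], h1 b,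
      by rw [h', Matrix.neg_mul, E.bilinear_mul_V h, neg_mul, Matrix.mul_neg]⟩

variable {E}

theorem IsSpread.conj_pauliString {A B : Finset (Site D L)} {Y : QubitOp n}
    (h : E.IsSpread A B Y) (s : Fin n → Fin 4) :
    E.IsSpread A B (conjBy (pauliString s) Y) := by
  intro W hW
  obtain ⟨OA, hA, OB, hB, hA', hB', hY⟩ := h _ (hW.mul (isPauliLike_pauliString s))
  refine ⟨OA, hA, OB, hB, hA', hB', ?_⟩
  rw [← hY, conjBy_apply, Matrix.conjTranspose_mul, pauliString_conjTranspose]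
  simp only [mul_assoc, Matrix.mul_assoc]

theorem even_conj_odd {A R : Finset (Site D L)} {F Y : FermionOp D L} (hF : F ∈ evenOps R)
    (hY : Y ∈ oddOps A) : F.conjTranspose * Y * F ∈ oddOps (A ∪ R) :=
  odd_mul_even (even_mul_odd (evenOps_mono Finset.subset_union_right
    (conjTranspose_mem_evenOps hF)) (oddOps_mono Finset.subset_union_left hY))
    (evenOps_mono Finset.subset_union_right hF)

theorem conj_unitary {ι : Type*} [Fintype ι] [DecidableEq ι] {F Y : Matrix ι ι ℂ}
    (hF : F.conjTranspose * F = 1) (hY : Y.conjTranspose * Y = 1) :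
    (F.conjTranspose * Y * F).conjTranspose * (F.conjTranspose * Y * F) = 1 := by
  have hF' : F * F.conjTranspose = 1 := mul_eq_one_comm.1 hF
  simp only [Matrix.conjTranspose_mul, Matrix.conjTranspose_conjTranspose, mul_assoc]
  rw [← mul_assoc F, hF', one_mul, ← mul_assoc Y.conjTranspose, hY, one_mul, hF]

theorem list_prod_unitary {ι γ : Type*} [Fintype ι] [DecidableEq ι] (U : γ → Matrix ι ι ℂ)
    (gs : List γ) (h : ∀ g ∈ gs, (U g).conjTranspose * U g = 1) :
    (gs.map U).prod.conjTranspose * (gs.map U).prod = 1 := by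
  induction gs with
  | nil => simp
  | cons g gs ih =>
    rw [List.map_cons, List.prod_cons, Matrix.conjTranspose_mul, mul_assoc,
      ← mul_assoc _ (U g), h g (by simp), one_mul, ih fun g hg => h g (by simp [hg])]

theorem oddUnitary_lightcone {ℓ : ℕ} {γ : Type*} (reg : γ → Finset (Site D L))
    (F : γ → FermionOp D L) (gs : List γ)
    (hdiam : ∀ g ∈ gs, ∀ r ∈ reg g, ∀ s ∈ reg g, siteDist r s ≤ ℓ)
    (hdisj : gs.Pairwise fun g h => Disjoint (reg g) (reg h))
    (hF : ∀ g ∈ gs, F g ∈ evenOps (reg g)) (hu : ∀ g ∈ gs, (F g).conjTranspose * F g = 1)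
    {A : Finset (Site D L)} {Y : FermionOp D L} (hY : Y ∈ oddOps A)
    (hYu : Y.conjTranspose * Y = 1) :
    (gs.map F).prod.conjTranspose * Y * (gs.map F).prod ∈ oddOps (thicken A ℓ) ∧
      ((gs.map F).prod.conjTranspose * Y * (gs.map F).prod).conjTranspose *
        ((gs.map F).prod.conjTranspose * Y * (gs.map F).prod) = 1 := by
  refine lightcone (fun A Y => Y ∈ oddOps A ∧ Y.conjTranspose * Y = 1) ℓ reg F gs hdiam hdisj
    (fun A B Y h hY => ⟨oddOps_mono h hY.1, hY.2⟩)
    (fun g hg A Y hY => ⟨even_conj_odd (hF g hg) hY.1, conj_unitary (hu g hg) hY.2⟩)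
    (fun g hg A Y hd hY => ?_) A Y ⟨hY, hYu⟩
  rw [mul_assoc, ← even_commute_odd hd.symm (hF g hg) hY.1, ← mul_assoc, hu g hg, one_mul]

/-- Conjugating the layer by `W` yields `Q = W U Wᴴ`, a product of unitaries in the same region
algebras. These lift to even fermionic unitaries on the same disjoint regions, in general different
from the fermionic gates of the circuit, and the light cone lemma applies to each odd factor
separately. -/
theorem IsSpread.conj_layer {ℓ : ℕ} {r s : Site D L} (hrs : ℓ < siteDist r s)
    {A B : Finset (Site D L)} {Y : QubitOp n} (h : E.IsSpread A B Y) (l : Layer E ℓ) :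
    E.IsSpread (thicken A ℓ) (thicken B ℓ) (conjBy l.qubit Y) := by
  intro W hW
  have hW' : W.conjTranspose * W = 1 := hW.unitary
  have hlift : ∀ g : LocalGate E ℓ, ∃ F, F ∈ evenOps g.region ∧ F.conjTranspose * F = 1 ∧
      (W * g.qubit * W.conjTranspose) * E.V = E.V * F := fun g => by
    -- No gate covers the lattice, as `r` and `s` are further apart than its diameter; this supplies
    -- the spare site needed for a unitary lift.
    obtain ⟨t, ht⟩ : ∃ t, t ∉ g.region := by
      by_contra! hall
      exact absurd (g.diam_le r (hall r) s (hall s)) (by omega)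
    have hu : g.qubit.conjTranspose * g.qubit = 1 := by
      simpa [Matrix.star_eq_conjTranspose] using Matrix.mem_unitaryGroup_iff'.1 g.qubit_unitary
    have hu' := conj_unitary (F := W.conjTranspose) (Y := g.qubit)
      (by rw [Matrix.conjTranspose_conjTranspose]; exact mul_eq_one_comm.1 hW') hu
    rw [Matrix.conjTranspose_conjTranspose] at hu'
    obtain ⟨F, h1, h2, h3⟩ := E.exists_unitary_lift ht
      (E.conj_mem_regionAlgebra hW g.qubit_mem) hu'
    exact ⟨F, h1, h2, h3⟩
  choose F hFe hFu hFV using hlift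
  set Φ : FermionOp D L := (l.gates.map F).prod
  set Q : QubitOp n := W * l.qubit * W.conjTranspose with hQ
  have hQV : Q * E.V = E.V * Φ := by
    have : ∀ gs : List (LocalGate E ℓ),
        W * (gs.map LocalGate.qubit).prod * W.conjTranspose * E.V = E.V * (gs.map F).prod := by
      intro gs
      induction gs with
      | nil => simp [mul_eq_one_comm.1 hW']
      | cons g gs ih =>
        rw [List.map_cons, List.prod_cons, List.map_cons, List.prod_cons]
        calc _ = W * g.qubit * 1 * (gs.map LocalGate.qubit).prod * W.conjTranspose * E.V := by
              simp only [mul_assoc, one_mul]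
          _ = W * g.qubit * W.conjTranspose *
              (W * (gs.map LocalGate.qubit).prod * W.conjTranspose * E.V) := by
              rw [← hW']; simp only [mul_assoc, Matrix.mul_assoc]
          _ = _ := by
              rw [ih, ← Matrix.mul_assoc, hFV, Matrix.mul_assoc]
    exact this l.gates
  have hlu : l.qubit.conjTranspose * l.qubit = 1 := list_prod_unitary _ _ fun g _ => by
    simpa [Matrix.star_eq_conjTranspose] using Matrix.mem_unitaryGroup_iff'.1 g.qubit_unitary
  have hQu : Q.conjTranspose * Q = 1 := by
    have := conj_unitary (F := W.conjTranspose) (Y := l.qubit)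
      (by rw [Matrix.conjTranspose_conjTranspose]; exact mul_eq_one_comm.1 hW') hlu
    rwa [Matrix.conjTranspose_conjTranspose] at this
  have hΦu : Φ.conjTranspose * Φ = 1 := list_prod_unitary _ _ fun g _ => hFu g
  obtain ⟨OA, hA, OB, hB, hA', hB', hY⟩ := h W hW
  obtain ⟨hA1, hA2⟩ := oddUnitary_lightcone LocalGate.region F l.gates (fun g _ => g.diam_le)
    l.disjoint (fun g _ => hFe g) (fun g _ => hFu g) hA hA'
  obtain ⟨hB1, hB2⟩ := oddUnitary_lightcone LocalGate.region F l.gates (fun g _ => g.diam_le)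
    l.disjoint (fun g _ => hFe g) (fun g _ => hFu g) hB hB'
  refine ⟨_, hA1, _, hB1, hA2, hB2, ?_⟩
  have h1 : W * conjBy l.qubit Y * W.conjTranspose =
      Q.conjTranspose * (W * Y * W.conjTranspose) * Q := by
    rw [conjBy_apply, hQ]
    simp only [Matrix.conjTranspose_mul, Matrix.conjTranspose_conjTranspose]
    calc _ = W * l.qubit.conjTranspose * 1 * Y * 1 * l.qubit * W.conjTranspose := by
          simp only [mul_assoc, one_mul]
      _ = _ := by rw [← hW']; simp only [mul_assoc]
  rw [h1, Matrix.mul_assoc, hQV, ← Matrix.mul_assoc, Matrix.mul_assoc Q.conjTranspose, hY,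
    ← Matrix.mul_assoc, E.conjTranspose_mul_V hQu hΦu hQV]
  have hΦ' : Φ * Φ.conjTranspose = 1 := mul_eq_one_comm.1 hΦu
  calc E.V * Φ.conjTranspose * (OA * OB) * Φ
      -- The inserted identity becomes `Φ * Φᴴ`, so that each odd factor is conjugated on its own.
      = E.V * (Φ.conjTranspose * OA * 1 * OB * Φ) := by
        simp only [Matrix.mul_assoc, mul_assoc, one_mul]
    _ = _ := by rw [← hΦ']; simp only [mul_assoc]; rfl

end LocalEncoding

/-! ### Qubits in the light cone of a bilinear -/

/-- The qubits on which a Pauli string acts nontrivially. -/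
def stringSupport {n : ℕ} (s : Fin n → Fin 4) : Finset (Fin n) :=
  Finset.univ.filter fun j => s j ≠ 0

namespace LocalEncoding

variable {D L n φ₀ : ℕ} (E : LocalEncoding D L n φ₀)

/-- The algebra generated by the string of `γ_a γ_b` and by the strings of the short-range
bilinears of the region `G`. -/
def coneAlgebra (ℓ : ℕ) (a b : Mode D L) (G : Finset (Site D L)) : Subalgebra ℂ (QubitOp n) :=
  Algebra.adjoin ℂ ({E.bilinear a b} ∪ {M | ∃ c d : Mode D L, c.1 ∈ G ∧ d.1 ∈ G ∧ c ≠ d ∧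
    siteDist c.1 d.1 ≤ ℓ ∧ M = E.bilinear c d})

/-- The qubits on which the cone algebra acts. -/
def coneQubits (ℓ : ℕ) (a b : Mode D L) (G : Finset (Site D L)) : Finset (Fin n) :=
  stringSupport (E.string a b) ∪ (G ×ˢ Finset.univ).biUnion fun c : Mode D L =>
    (siteBall c.1 ℓ ×ˢ Finset.univ).biUnion fun d : Mode D L =>
      if c = d then ∅ else stringSupport (E.string c d)

/-- Only the string of `γ_a γ_b` may be long. All other generators join sites at distance at most
`ℓ`, so they have weight at most `φ₀ + ℓ` and their number is proportional to the size of `G`. -/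
theorem card_coneQubits_le {ℓ : ℕ} {a b : Mode D L} (hab : a ≠ b) (G : Finset (Site D L)) :
    (E.coneQubits ℓ a b G).card ≤
      φ₀ + siteDist a.1 b.1 + G.card * 2 * ((2 * ℓ + 1) ^ D * 2 * (φ₀ + ℓ)) := by
  refine (Finset.card_union_le _ _).trans (add_le_add (E.weight_le a b hab) ?_)
  refine (Finset.card_biUnion_le_card_mul _ _ ((2 * ℓ + 1) ^ D * 2 * (φ₀ + ℓ)) ?_).trans ?_
  · intro c _
    refine (Finset.card_biUnion_le_card_mul _ _ (φ₀ + ℓ) ?_).trans ?_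
    · intro d hd
      have hd : siteDist c.1 d.1 ≤ ℓ := by
        simpa using (Finset.mem_product.1 hd).1
      split_ifs with h
      · simp
      · exact (E.weight_le c d h).trans (by omega)
    · rw [Finset.card_product]
      refine Nat.mul_le_mul_right _ (Nat.mul_le_mul (card_siteBall_le c.1 ℓ) ?_)
      simp
  · rw [Finset.card_product]
    simp

theorem regionAlgebra_le_coneAlgebra {ℓ : ℕ} {a b : Mode D L} {R G : Finset (Site D L)}
    (hR : ∀ r ∈ R, ∀ s ∈ R, siteDist r s ≤ ℓ) (h : R ⊆ G) :
    E.regionAlgebra R ≤ E.coneAlgebra ℓ a b G := by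
  refine Algebra.adjoin_mono ?_
  rintro _ ⟨c, d, hc, hd, hcd, rfl⟩
  exact Or.inr ⟨c, d, h hc, h hd, hcd, hR _ hc _ hd, rfl⟩

theorem coneAlgebra_mono {ℓ : ℕ} {a b : Mode D L} {G H : Finset (Site D L)} (h : G ⊆ H) :
    E.coneAlgebra ℓ a b G ≤ E.coneAlgebra ℓ a b H := by
  refine Algebra.adjoin_mono (Set.union_subset_union_right _ ?_)
  rintro _ ⟨c, d, hc, hd, hcd, hdist, rfl⟩
  exact ⟨c, d, h hc, h hd, hcd, hdist, rfl⟩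

theorem conjTranspose_mem_regionAlgebra {A : Finset (Site D L)} {q : QubitOp n}
    (hq : q ∈ E.regionAlgebra A) : q.conjTranspose ∈ E.regionAlgebra A := by
  refine conjTranspose_mem_adjoin ?_ hq
  rintro _ ⟨a, b, ha, hb, hab, rfl⟩
  obtain ⟨z, hz⟩ := E.bilinear_conjTranspose a b
  rw [hz]
  exact Subalgebra.smul_mem _ 
    (Algebra.subset_adjoin (show _ ∈ _ from ⟨a, b, ha, hb, hab, rfl⟩) :
      E.bilinear a b ∈ E.regionAlgebra A) z

theorem regionAlgebra_commute_cone (hV : E.V ≠ 0) {ℓ : ℕ} {a b : Mode D L} (hab : a ≠ b)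
    {R G : Finset (Site D L)} (ha : a.1 ∈ G) (hb : b.1 ∈ G) (h : Disjoint G R) {q Y : QubitOp n}
    (hq : q ∈ E.regionAlgebra R) (hY : Y ∈ E.coneAlgebra ℓ a b G) : Y * q = q * Y := by
  have hne : ∀ {c d : Mode D L}, c.1 ∈ G → d.1 ∈ R → c ≠ d := fun hc hd hcd =>
    Finset.disjoint_left.1 h hc (hcd ▸ hd)
  refine commute_of_mem_adjoin ?_ hY
  intro g hg
  symm
  refine commute_of_mem_adjoin ?_ hq
  rintro _ ⟨c, d, hc, hd, hcd, rfl⟩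
  rcases hg with rfl | ⟨c', d', hc', hd', hcd', -, rfl⟩
  · exact E.bilinear_commute hV hcd hab (hne ha hc).symm (hne hb hc).symm (hne ha hd).symm
      (hne hb hd).symm
  · exact E.bilinear_commute hV hcd hcd' (hne hc' hc).symm (hne hd' hc).symm (hne hc' hd).symm
      (hne hd' hd).symm

theorem conj_pauliString_of_mem_cone {ℓ : ℕ} {a b : Mode D L} {G : Finset (Site D L)}
    {Y : QubitOp n} (hY : Y ∈ E.coneAlgebra ℓ a b G) {s : Fin n → Fin 4}
    (hs : ∀ j ∈ E.coneQubits ℓ a b G, s j = 0) : conjBy (pauliString s) Y = Y := by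
  have hcomm : Y * pauliString s = pauliString s * Y := by
    refine commute_of_mem_adjoin ?_ hY
    have hstring : ∀ c d : Mode D L, stringSupport (E.string c d) ⊆ E.coneQubits ℓ a b G →
        E.bilinear c d * pauliString s = pauliString s * E.bilinear c d := fun c d h => by
      rw [bilinear, smul_mul_assoc, mul_smul_comm, pauliString_commute_of_disjoint]
      intro j hj
      by_contra hj'
      exact hj (hs j (h (by simpa [stringSupport] using hj')))
    rintro g (rfl | ⟨c, d, hc, hd, hcd, hdist, rfl⟩)
    · exact hstring a b Finset.subset_union_left
    · refine hstring c d (subset_trans ?_ Finset.subset_union_right)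
      intro j hj
      refine Finset.mem_biUnion.2 ⟨c, by simpa using hc, Finset.mem_biUnion.2 ⟨d, ?_, ?_⟩⟩
      · simpa using hdist
      · rwa [if_neg hcd]
  rw [conjBy_apply, pauliString_conjTranspose, mul_assoc, hcomm, ← mul_assoc, pauliString_mul_self,
    one_mul]

end LocalEncoding

/-! ### Circuits acting on encoded observables -/

section Circuit

variable {D L n φ₀ ℓ : ℕ} {E : LocalEncoding D L n φ₀}

theorem LocalGate.qubit_conjTranspose_mul (g : LocalGate E ℓ) :
    g.qubit.conjTranspose * g.qubit = 1 := by
  simpa [Matrix.star_eq_conjTranspose] using Matrix.mem_unitaryGroup_iff'.1 g.qubit_unitary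

theorem Layer.qubit_conjTranspose_mul (l : Layer E ℓ) :
    l.qubit.conjTranspose * l.qubit = 1 :=
  LocalEncoding.list_prod_unitary _ _ fun g _ => g.qubit_conjTranspose_mul

theorem Layer.fermion_mem_evenOps (l : Layer E ℓ) : l.fermion ∈ evenOps Finset.univ := by
  unfold Layer.fermion
  induction l.gates with
  | nil => exact one_mem_evenOps _
  | cons g gs ih =>
    rw [List.map_cons, List.prod_cons]
    exact even_mul_even (evenOps_mono (Finset.subset_univ _) g.fermion_even) ih

theorem Layer.qubit_mul_V (l : Layer E ℓ) : l.qubit * E.V = E.V * l.fermion := by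
  unfold Layer.qubit Layer.fermion
  induction l.gates with
  | nil => simp
  | cons g gs ih =>
    rw [List.map_cons, List.prod_cons, List.map_cons, List.prod_cons, Matrix.mul_assoc, ih,
      ← Matrix.mul_assoc, g.intertwines, Matrix.mul_assoc]

/-- A gate disjoint from the cone commutes with all its generators and cancels; a gate that touches
the cone adds only short bilinears of its own region. -/
theorem idealObs_mem_cone (hV : E.V ≠ 0) {a b : Mode D L} (hab : a ≠ b) (c : List (Layer E ℓ)) :
    idealObs c (E.bilinear a b) ∈ E.coneAlgebra ℓ a b
      (siteBall a.1 (c.length * ℓ) ∪ siteBall b.1 (c.length * ℓ)) := by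
  induction c with
  | nil => exact Algebra.subset_adjoin (Or.inl rfl)
  | cons l c ih =>
    rw [idealObs, conjBy_apply]
    have := lightcone (fun G Y => a.1 ∈ G ∧ b.1 ∈ G ∧ Y ∈ E.coneAlgebra ℓ a b G) ℓ
      LocalGate.region LocalGate.qubit l.gates (fun g _ => g.diam_le) l.disjoint
      (fun A B Y h hY => ⟨h hY.1, h hY.2.1, E.coneAlgebra_mono h hY.2.2⟩)
      (fun g _ A Y hY => ⟨Finset.mem_union_left _ hY.1, Finset.mem_union_left _ hY.2.1, ?_⟩)
      (fun g _ A Y hd hY => ?_) _ _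
      ⟨Finset.mem_union_left _ (self_mem_siteBall _ _),
        Finset.mem_union_right _ (self_mem_siteBall _ _), ih⟩
    · refine E.coneAlgebra_mono ?_ this.2.2
      rw [thicken_union, List.length_cons, Nat.succ_mul]
      exact Finset.union_subset_union (thicken_siteBall_subset _ _ _)
        (thicken_siteBall_subset _ _ _)
    · have h1 := E.regionAlgebra_le_coneAlgebra (a := a) (b := b) (G := A ∪ g.region) g.diam_le
        Finset.subset_union_right
      exact mul_mem (mul_mem (h1 (E.conjTranspose_mem_regionAlgebra g.qubit_mem))
        (E.coneAlgebra_mono Finset.subset_union_left hY.2.2)) (h1 g.qubit_mem)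
    · rw [mul_assoc, E.regionAlgebra_commute_cone hV hab hY.1 hY.2.1 hd g.qubit_mem hY.2.2,
        ← mul_assoc, g.qubit_conjTranspose_mul, one_mul]

/-! ### Expectation values in the encoded initial state -/

/-- The expectation value in the encoded state. -/
noncomputable def encodedExp (E : LocalEncoding D L n φ₀) (ρ : FermionOp D L) :
    QubitOp n →ₗ[ℂ] ℂ :=
  (Matrix.traceLinearMap _ ℂ ℂ).comp (LinearMap.mulRight ℂ (E.V * ρ * E.V.conjTranspose))

theorem encodedExp_apply (ρ : FermionOp D L) (Y : QubitOp n) :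
    encodedExp E ρ Y = (Y * (E.V * ρ * E.V.conjTranspose)).trace := rfl

theorem encodedExp_of_mul_V {ρ : FermionOp D L} (hρ : ρ * E.sector = ρ) {Y : QubitOp n}
    {X : FermionOp D L} (h : Y * E.V = E.V * X) : encodedExp E ρ Y = (X * ρ).trace := by
  rw [encodedExp_apply, ← Matrix.mul_assoc, ← Matrix.mul_assoc, h, Matrix.trace_mul_comm,
    ← Matrix.mul_assoc, ← Matrix.mul_assoc, E.isometry, Matrix.mul_assoc, Matrix.trace_mul_comm,
    Matrix.mul_assoc, hρ]

theorem trace_idealState (c : List (Layer E ℓ)) {σ : FermionOp D L} (hσ : σ * E.sector = σ)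
    {Y : QubitOp n} {X : FermionOp D L} (h : Y * E.V = E.V * X) :
    (X * idealState c σ).trace = encodedExp E σ (idealObs c Y) := by
  induction c generalizing σ with
  | nil => exact (encodedExp_of_mul_V hσ h).symm
  | cons l c ih =>
    have h1 : idealState (l :: c) σ = idealState c (l.fermion * σ * l.fermion.conjTranspose) := rfl
    rw [h1, ih, encodedExp_apply, encodedExp_apply, idealObs, conjBy_apply]
    · have h2 : E.V * (l.fermion * σ * l.fermion.conjTranspose) * E.V.conjTranspose =
          l.qubit * (E.V * σ * E.V.conjTranspose) * l.qubit.conjTranspose := by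
        have h3 : l.fermion.conjTranspose * E.V.conjTranspose =
            E.V.conjTranspose * l.qubit.conjTranspose := by
          rw [← Matrix.conjTranspose_mul, ← l.qubit_mul_V, Matrix.conjTranspose_mul]
        calc _ = (E.V * l.fermion) * σ * (l.fermion.conjTranspose * E.V.conjTranspose) := by
              simp only [Matrix.mul_assoc, mul_assoc]
          _ = _ := by
              rw [h3, ← l.qubit_mul_V]; simp only [Matrix.mul_assoc, mul_assoc]
      rw [h2, ← mul_assoc, Matrix.trace_mul_comm]
      simp only [mul_assoc]
    -- Even unitaries preserve the sector, so the evolved state is still supported on the encoded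
    -- states.
    · rw [mul_assoc, ← E.sector_commute (conjTranspose_mem_evenOps l.fermion_mem_evenOps),
        ← mul_assoc, mul_assoc l.fermion, hσ]

theorem trace_noisyState (c : List (Layer E ℓ)) (p αx αy αz : ℝ) (ρ : FermionOp D L)
    (Y : QubitOp n) :
    (Y * noisyState c p αx αy αz ρ).trace = encodedExp E ρ (noisyObs p αx αy αz c Y) :=
  trace_noisyObs c Y _

theorem trace_conjTranspose_mul_self_re {m k : Type*} [Fintype m] [Fintype k] (C : Matrix m k ℂ) :
    (C.conjTranspose * C).trace.re = ∑ i, ∑ j, ‖C i j‖ ^ 2 := by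
  rw [Finset.sum_comm, Matrix.trace, Complex.re_sum]
  refine Finset.sum_congr rfl fun j _ => ?_
  rw [Matrix.diag_apply, Matrix.mul_apply, Complex.re_sum]
  refine Finset.sum_congr rfl fun i _ => ?_
  rw [Matrix.conjTranspose_apply, RCLike.star_def, Complex.conj_mul']
  norm_cast

/-- Since `Y` is unitary, `Y * Bᴴ` and `B` have the same Hilbert-Schmidt norm, so the entrywise
inequality of arithmetic and geometric means already gives the Cauchy-Schwarz bound. -/
theorem norm_trace_mul_le {ι κ : Type*} [Fintype ι] [Fintype κ] [DecidableEq ι]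
    (B : Matrix κ ι ℂ) {Y : Matrix ι ι ℂ} (hY : Y.conjTranspose * Y = 1) :
    ‖(Y * (B.conjTranspose * B)).trace‖ ≤ (B.conjTranspose * B).trace.re := by
  set C : Matrix ι κ ℂ := Y * B.conjTranspose with hC
  have hCC : (C.conjTranspose * C).trace = (B.conjTranspose * B).trace := by
    rw [hC, Matrix.conjTranspose_mul, Matrix.conjTranspose_conjTranspose, Matrix.mul_assoc,
      ← Matrix.mul_assoc Y.conjTranspose, hY, Matrix.one_mul, Matrix.trace_mul_comm]
  have h1 : (Y * (B.conjTranspose * B)).trace = ∑ i, ∑ j, C i j * B j i := by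
    rw [← Matrix.mul_assoc, Matrix.trace]
    simp only [Matrix.diag_apply, Matrix.mul_apply (M := Y * B.conjTranspose), hC]
  have h2 : ∑ i, ∑ j, ‖B j i‖ ^ 2 = (B.conjTranspose * B).trace.re := by
    rw [trace_conjTranspose_mul_self_re B, Finset.sum_comm]
  rw [h1]
  calc ‖∑ i, ∑ j, C i j * B j i‖ ≤ ∑ i, ∑ j, (‖C i j‖ ^ 2 + ‖B j i‖ ^ 2) / 2 := by
        refine norm_sum_le_of_le _ fun i _ => norm_sum_le_of_le _ fun j _ => ?_
        rw [norm_mul]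
        nlinarith [sq_nonneg (‖C i j‖ - ‖B j i‖)]
    _ = ((∑ i, ∑ j, ‖C i j‖ ^ 2) + ∑ i, ∑ j, ‖B j i‖ ^ 2) / 2 := by
        simp only [← Finset.sum_div, Finset.sum_add_distrib]
    _ = (B.conjTranspose * B).trace.re := by
        rw [h2, ← trace_conjTranspose_mul_self_re C, hCC]; ring

open scoped MatrixOrder in
theorem norm_encodedExp_le_one {ρ : FermionOp D L} (hρ : IsState ρ) (hs : ρ * E.sector = ρ)
    {Y : QubitOp n} (hY : Y.conjTranspose * Y = 1) : ‖encodedExp E ρ Y‖ ≤ 1 := by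
  obtain ⟨B, hB⟩ : ∃ B : FermionOp D L, ρ = B.conjTranspose * B :=
    CStarAlgebra.nonneg_iff_eq_star_mul_self.1 (Matrix.PosSemidef.nonneg hρ.1)
  have h1 : E.V * ρ * E.V.conjTranspose =
      (B * E.V.conjTranspose).conjTranspose * (B * E.V.conjTranspose) := by
    rw [hB, Matrix.conjTranspose_mul, Matrix.conjTranspose_conjTranspose]
    simp only [Matrix.mul_assoc]
  have h2 := encodedExp_of_mul_V (E := E) hs (Y := 1) (X := 1) (by simp)
  rw [encodedExp_apply, one_mul, one_mul, hρ.2] at h2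
  rw [encodedExp_apply, h1]
  refine (norm_trace_mul_le _ hY).trans ?_
  rw [← h1, h2]; simp

theorem norm_encodedExp_le_of_isSpread {ρ : FermionOp D L} (hs : ρ * E.sector = ρ) {K μ : ℝ}
    (hK : 0 ≤ K) (hμ : 0 ≤ μ) (hcl : Clusters ρ K μ) {r s : Site D L} {k : ℕ}
    (h : 2 * k < siteDist r s) {Y : QubitOp n}
    (hY : E.IsSpread (siteBall r k) (siteBall s k) Y) :
    ‖encodedExp E ρ Y‖ ≤ K / ((siteDist r s - 2 * k : ℕ) : ℝ) ^ μ := by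
  obtain ⟨OA, hA, OB, hB, hA', hB', hYV⟩ := hY 1 isPauliLike_one
  rw [one_mul, Matrix.conjTranspose_one, mul_one] at hYV
  rw [encodedExp_of_mul_V hs hYV]
  refine (hcl _ _ ⟨r, self_mem_siteBall r k⟩ ⟨s, self_mem_siteBall s k⟩ (disjoint_siteBall h)
    OA hA OB hB).trans ?_
  have h1 : ((siteDist r s - 2 * k : ℕ) : ℝ) ^ μ ≤
      (regionDist (siteBall r k) (siteBall s k) : ℝ) ^ μ :=
    Real.rpow_le_rpow (by positivity) (Nat.cast_le.2 (le_regionDist_siteBall r s k)) hμ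
  have h2 : (0 : ℝ) < ((siteDist r s - 2 * k : ℕ) : ℝ) ^ μ :=
    Real.rpow_pos_of_pos (by exact_mod_cast Nat.sub_pos_of_lt h) _
  calc _ ≤ 1 * (K / (regionDist (siteBall r k) (siteBall s k) : ℝ) ^ μ) := by
        refine mul_le_mul_of_nonneg_right ?_ (by positivity)
        exact mul_le_one₀ (opNorm_le_one hA') (opNorm_nonneg _) (opNorm_le_one hB')
    _ ≤ _ := by
        rw [one_mul]
        exact div_le_div_of_nonneg_left hK h2 h1

/-! ### The error of a single bilinear -/

/-- The error of the expectation value of `γ_a γ_b`. -/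
noncomputable def pairError (E : LocalEncoding D L n φ₀) (c : List (Layer E ℓ)) (p αx αy αz : ℝ)
    (ρ : FermionOp D L) (a b : Mode D L) : ℂ :=
  encodedExp E ρ (noisyObs p αx αy αz c (E.bilinear a b)) -
    encodedExp E ρ (idealObs c (E.bilinear a b))

theorem V_ne_zero {ρ : FermionOp D L} (hρ : IsState ρ) (hs : E.sector * ρ = ρ) : E.V ≠ 0 := by
  intro h
  rw [← E.isometry, h, Matrix.mul_zero, Matrix.zero_mul] at hs
  have := hρ.2
  rw [← hs] at this
  simp at this

theorem sector_mul_of_isState {ρ : FermionOp D L} (hρ : IsState ρ) (hs : E.sector * ρ = ρ) :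
    ρ * E.sector = ρ := by
  have h1 : E.sector.conjTranspose = E.sector := by
    rw [← E.isometry, Matrix.conjTranspose_mul, Matrix.conjTranspose_conjTranspose]
  have := congrArg Matrix.conjTranspose hs
  rwa [Matrix.conjTranspose_mul, h1, hρ.1.isHermitian.eq] at this

/-- A bound on the number of qubits in the light cone of a bilinear. -/
theorem card_coneQubits_ball_le {a b : Mode D L} (hab : a ≠ b) {d : ℕ} (hd : 1 ≤ d) :
    (E.coneQubits ℓ a b (siteBall a.1 (d * ℓ) ∪ siteBall b.1 (d * ℓ))).card ≤
      φ₀ + siteDist a.1 b.1 + 8 * (2 * ℓ + 1) ^ (2 * D) * (φ₀ + ℓ) * d ^ D := by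
  refine (E.card_coneQubits_le hab _).trans (Nat.add_le_add_left ?_ _)
  have h1 : ∀ r : Site D L, (siteBall r (d * ℓ)).card ≤ (2 * ℓ + 1) ^ D * d ^ D := fun r => by
    refine (card_siteBall_le r _).trans ?_
    rw [← mul_pow]
    exact Nat.pow_le_pow_left (by nlinarith) _
  have h2 := (Finset.card_union_le (siteBall a.1 (d * ℓ)) (siteBall b.1 (d * ℓ))).trans
    (add_le_add (h1 a.1) (h1 b.1))
  calc _ ≤ ((2 * ℓ + 1) ^ D * d ^ D + (2 * ℓ + 1) ^ D * d ^ D) * 2 *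
        ((2 * ℓ + 1) ^ D * 2 * (φ₀ + ℓ)) :=
        Nat.mul_le_mul_right _ (Nat.mul_le_mul_right _ h2)
    -- The factor `8` collects two balls and two Majoranas on each of the two sites of a bilinear.
    _ = _ := by rw [two_mul D, pow_add]; ring

variable {p αx αy αz : ℝ}

/-- The common form of the near and far estimates: the choice of the class `S` only affects `κ`,
while the number of sensitive qubits comes from the light cone in both cases. -/
theorem norm_pairError_le_of_class (hp : NoiseParams p αx αy αz) {ρ : FermionOp D L}
    (hρ : IsState ρ) (hs : E.sector * ρ = ρ) {c : List (Layer E ℓ)} (hc : 1 ≤ c.length)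
    {a b : Mode D L} (hab : a ≠ b) (S : ℕ → Set (QubitOp n))
    (hS : ∀ k, ∀ Z ∈ S k, ∀ s, conjBy (pauliString s) Z ∈ S k)
    (hU : ∀ k, ∀ Z ∈ S k, ∀ l : Layer E ℓ, conjBy l.qubit Z ∈ S (k + 1))
    (hY : E.bilinear a b ∈ S 0) {κ : ℝ} (hκ : ∀ Z ∈ S c.length, ‖encodedExp E ρ Z‖ ≤ κ)
    (hκ0 : 0 ≤ κ) :
    ‖pairError E c p αx αy αz ρ a b‖ ≤ 2 * κ * min 1 (c.length * (p * (φ₀ + siteDist a.1 b.1 +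
      (8 * (2 * ℓ + 1) ^ (2 * D) * (φ₀ + ℓ) : ℕ) * (c.length : ℝ) ^ D))) := by
  have hV := V_ne_zero hρ hs
  refine (norm_noisyObs_sub_idealObs_le hp S hS hU hY (E.coneQubits ℓ a b
    (siteBall a.1 (c.length * ℓ) ∪ siteBall b.1 (c.length * ℓ))) c.length ?_ c le_rfl
    (encodedExp E ρ) κ hκ).trans ?_
  · intro c' hc' s hs
    have hsub : siteBall a.1 (c'.length * ℓ) ∪ siteBall b.1 (c'.length * ℓ) ⊆
        siteBall a.1 (c.length * ℓ) ∪ siteBall b.1 (c.length * ℓ) :=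
      Finset.union_subset_union (siteBall_subset _ (Nat.mul_le_mul_right _ hc'))
        (siteBall_subset _ (Nat.mul_le_mul_right _ hc'))
    exact E.conj_pauliString_of_mem_cone
      (E.coneAlgebra_mono hsub (idealObs_mem_cone hV hab c')) hs
  · refine mul_le_mul_of_nonneg_left (min_le_min le_rfl ?_) (by positivity)
    refine mul_le_mul_of_nonneg_left ?_ (by positivity)
    have h1 : ((E.coneQubits ℓ a b
        (siteBall a.1 (c.length * ℓ) ∪ siteBall b.1 (c.length * ℓ))).card : ℝ) ≤
        φ₀ + siteDist a.1 b.1 +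
          (8 * (2 * ℓ + 1) ^ (2 * D) * (φ₀ + ℓ) : ℕ) * (c.length : ℝ) ^ D := by
      exact_mod_cast card_coneQubits_ball_le (E := E) (ℓ := ℓ) hab hc
    have h2 := hp.p_nonneg
    calc _ ≤ (φ₀ + siteDist a.1 b.1 +
          (8 * (2 * ℓ + 1) ^ (2 * D) * (φ₀ + ℓ) : ℕ) * (c.length : ℝ) ^ D) * (3 / 4 * p) :=
          mul_le_mul_of_nonneg_right h1 (by positivity)
      _ ≤ _ := by
          rw [mul_comm]
          refine mul_le_mul_of_nonneg_right (by linarith) ?_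
          exact (Nat.cast_nonneg _).trans h1

/-- The class is that of all unitaries, with the trivial bound `κ = 1`. -/
theorem norm_pairError_le (hp : NoiseParams p αx αy αz) {ρ : FermionOp D L}
    (hρ : IsState ρ) (hs : E.sector * ρ = ρ) {c : List (Layer E ℓ)} (hc : 1 ≤ c.length)
    {a b : Mode D L} (hab : a ≠ b) :
    ‖pairError E c p αx αy αz ρ a b‖ ≤ 2 * 1 * min 1 (c.length * (p * (φ₀ + siteDist a.1 b.1 +
      (8 * (2 * ℓ + 1) ^ (2 * D) * (φ₀ + ℓ) : ℕ) * (c.length : ℝ) ^ D))) := by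
  have hs' := sector_mul_of_isState hρ hs
  refine norm_pairError_le_of_class hp hρ hs hc hab (fun _ => {Y | Y.conjTranspose * Y = 1})
    (fun k Z hZ s => ?_) (fun k Z hZ l => ?_) (E.bilinear_unitary a b)
    (fun Z hZ => norm_encodedExp_le_one hρ hs' hZ) zero_le_one
  · rw [conjBy_apply]
    exact LocalEncoding.conj_unitary (by rw [pauliString_conjTranspose, pauliString_mul_self]) hZ
  · rw [conjBy_apply]
    exact LocalEncoding.conj_unitary l.qubit_conjTranspose_mul hZ

/-- The class is that of spread operators. Beyond `4dℓ` the balls of radius `dℓ` are still at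
distance at least half of the original one, which costs the factor `2 ^ μ` in the clustering bound.
-/
theorem norm_pairError_far_le (hp : NoiseParams p αx αy αz) {ρ : FermionOp D L}
    (hρ : IsState ρ) (hs : E.sector * ρ = ρ) {K μ : ℝ} (hK : 0 ≤ K) (hμ : 0 ≤ μ)
    (hcl : Clusters ρ K μ) {c : List (Layer E ℓ)} (hc : 1 ≤ c.length) {a b : Mode D L}
    (hab : 4 * (c.length * ℓ) < siteDist a.1 b.1) :
    ‖pairError E c p αx αy αz ρ a b‖ ≤ 2 * (2 ^ μ * K * (siteDist a.1 b.1 : ℝ) ^ (-μ)) *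
      min 1 (c.length * (p * (φ₀ + siteDist a.1 b.1 +
      (8 * (2 * ℓ + 1) ^ (2 * D) * (φ₀ + ℓ) : ℕ) * (c.length : ℝ) ^ D))) := by
  have hs' := sector_mul_of_isState hρ hs
  have hne : a ≠ b := by
    rintro rfl
    rw [siteDist_self] at hab
    omega
  have hℓ : ℓ < siteDist a.1 b.1 := by nlinarith
  refine norm_pairError_le_of_class hp hρ hs hc hne
    (fun k => {Y | E.IsSpread (siteBall a.1 (k * ℓ)) (siteBall b.1 (k * ℓ)) Y})
    (fun k Z hZ s => hZ.conj_pauliString s) (fun k Z hZ l => ?_)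
    (E.isSpread_bilinear hne (self_mem_siteBall _ _) (self_mem_siteBall _ _))
    (fun Z hZ => ?_) (by positivity)
  · intro W hW
    obtain ⟨OA, hA, OB, hB, h⟩ := hZ.conj_layer hℓ l W hW
    refine ⟨OA, oddOps_mono ?_ hA, OB, oddOps_mono ?_ hB, h⟩ <;>
    · rw [Nat.succ_mul]; exact thicken_siteBall_subset _ _ _
  · refine (norm_encodedExp_le_of_isSpread hs' hK hμ hcl (by omega) hZ).trans ?_
    set r := siteDist a.1 b.1
    have hr : (0 : ℝ) < r := by exact_mod_cast (by omega : 0 < r)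
    have h1 : (r : ℝ) / 2 ≤ ((r - 2 * (c.length * ℓ) : ℕ) : ℝ) := by
      rw [div_le_iff₀ (by norm_num)]
      exact_mod_cast (by omega : r ≤ (r - 2 * (c.length * ℓ)) * 2)
    calc K / ((r - 2 * (c.length * ℓ) : ℕ) : ℝ) ^ μ ≤ K / ((r : ℝ) / 2) ^ μ :=
          div_le_div_of_nonneg_left hK (by positivity)
            (Real.rpow_le_rpow (by positivity) h1 hμ)
      _ = _ := by
          rw [Real.div_rpow hr.le (by norm_num), Real.rpow_neg hr.le]
          field_simp

end Circuit

/-! ### Duality between the trace norm and row sums -/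

/-- A Schur test along the singular vectors. With `U` diagonalizing `oᵀ o` and `X = o U`, one has `o
= X Uᵀ`, and column `i` of `X` has squared length equal to eigenvalue `i`. Splitting `B = √B √B` in
Cauchy-Schwarz bounds the contribution of column `i` by its singular value times `T`. -/
theorem norm_sum_mul_le_traceNorm {ι : Type*} [Fintype ι] [DecidableEq ι] (o : Matrix ι ι ℝ)
    (M : ι → ι → ℂ) (B : ι → ι → ℝ) (T : ℝ) (hMB : ∀ a b, ‖M a b‖ ≤ B a b)
    (hrow : ∀ a, ∑ b, B a b ≤ T) (hcol : ∀ b, ∑ a, B a b ≤ T) (hT : 0 ≤ T) :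
    ‖∑ a, ∑ b, (o a b : ℂ) * M a b‖ ≤ traceNorm o * T := by
  have hH := Matrix.isHermitian_conjTranspose_mul_self o
  set U : Matrix ι ι ℝ := (hH.eigenvectorUnitary : Matrix ι ι ℝ)
  have hB : ∀ a b, 0 ≤ B a b := fun a b => (norm_nonneg _).trans (hMB a b)
  have hU : U * star U = 1 := Unitary.coe_mul_star_self hH.eigenvectorUnitary
  have hU' : star U * U = 1 := Unitary.coe_star_mul_self hH.eigenvectorUnitary
  set X : Matrix ι ι ℝ := o * U with hX
  have ho : ∀ a b, o a b = ∑ i, X a i * U b i := fun a b => by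
    have : o = X * star U := by rw [hX, mul_assoc, hU, mul_one]
    conv_lhs => rw [this]
    simp [Matrix.mul_apply, Matrix.star_eq_conjTranspose]
  have hUcol : ∀ i, ∑ b, U b i ^ 2 = 1 := fun i => by
    have := congrFun (congrFun hU' i) i
    simpa [Matrix.mul_apply, Matrix.star_eq_conjTranspose, sq] using this
  have hXcol : ∀ i, ∑ a, X a i ^ 2 = hH.eigenvalues i := fun i => by
    have h1 : star X * X = Matrix.diagonal hH.eigenvalues := by
      have h2 := hH.conjStarAlgAut_star_eigenvectorUnitary
      rw [Unitary.conjStarAlgAut_apply] at h2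
      simp only [Unitary.coe_star, star_star] at h2
      rw [hX, star_mul, mul_assoc, ← mul_assoc (star o), ← mul_assoc]
      exact h2
    have := congrFun (congrFun h1 i) i
    simpa [Matrix.mul_apply, Matrix.star_eq_conjTranspose, sq] using this
  have key : ∀ i, ∑ a, ∑ b, |X a i| * |U b i| * B a b ≤ √(hH.eigenvalues i) * T := by
    intro i
    have hcs := Real.sum_mul_le_sqrt_mul_sqrt (Finset.univ : Finset (ι × ι))
      (fun x => |X x.1 i| * √(B x.1 x.2)) (fun x => |U x.2 i| * √(B x.1 x.2))
    rw [Fintype.sum_prod_type, Fintype.sum_prod_type, Fintype.sum_prod_type] at hcs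
    have e1 : ∑ a, ∑ b, (|X a i| * √(B a b)) * (|U b i| * √(B a b)) =
        ∑ a, ∑ b, |X a i| * |U b i| * B a b := by
      refine Finset.sum_congr rfl fun a _ => Finset.sum_congr rfl fun b _ => ?_
      rw [mul_mul_mul_comm, Real.mul_self_sqrt (hB a b)]
    have e2 : ∑ a, ∑ b, (|X a i| * √(B a b)) ^ 2 ≤ hH.eigenvalues i * T := by
      rw [← hXcol i, Finset.sum_mul]
      refine Finset.sum_le_sum fun a _ => ?_
      simp only [mul_pow, sq_abs, Real.sq_sqrt (hB a _), ← Finset.mul_sum]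
      exact mul_le_mul_of_nonneg_left (hrow a) (sq_nonneg _)
    have e3 : ∑ a, ∑ b, (|U b i| * √(B a b)) ^ 2 ≤ T := by
      rw [Finset.sum_comm, ← one_mul T, ← hUcol i, Finset.sum_mul]
      refine Finset.sum_le_sum fun b _ => ?_
      simp only [mul_pow, sq_abs, Real.sq_sqrt (hB _ b), ← Finset.mul_sum]
      exact mul_le_mul_of_nonneg_left (hcol b) (sq_nonneg _)
    rw [← e1]
    refine hcs.trans ?_
    calc _ ≤ √(hH.eigenvalues i * T) * √T :=
          mul_le_mul (Real.sqrt_le_sqrt e2) (Real.sqrt_le_sqrt e3) (Real.sqrt_nonneg _)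
            (Real.sqrt_nonneg _)
      _ = _ := by
          rw [Real.sqrt_mul' _ hT, mul_assoc, Real.mul_self_sqrt hT]
  calc ‖∑ a, ∑ b, (o a b : ℂ) * M a b‖ ≤ ∑ a, ∑ b, |o a b| * B a b := by
        refine norm_sum_le_of_le _ fun a _ => norm_sum_le_of_le _ fun b _ => ?_
        rw [norm_mul, Complex.norm_real, Real.norm_eq_abs]
        exact mul_le_mul_of_nonneg_left (hMB a b) (abs_nonneg _)
    _ ≤ ∑ a, ∑ b, ∑ i, |X a i| * |U b i| * B a b := by
        refine Finset.sum_le_sum fun a _ => Finset.sum_le_sum fun b _ => ?_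
        rw [← Finset.sum_mul, ho a b]
        refine mul_le_mul_of_nonneg_right ?_ (hB a b)
        refine (Finset.abs_sum_le_sum_abs _ _).trans (le_of_eq ?_)
        simp only [abs_mul]
    _ = ∑ i, ∑ a, ∑ b, |X a i| * |U b i| * B a b := by
        rw [Finset.sum_comm (s := Finset.univ (α := ι)) (f := fun i a => ∑ b, |X a i| * |U b i| * B a b)]
        exact Finset.sum_congr rfl fun a _ => Finset.sum_comm
    _ ≤ ∑ i, √(hH.eigenvalues i) * T := Finset.sum_le_sum fun i _ => key i
    _ = traceNorm o * T := by rw [← Finset.sum_mul]; rfl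

/-! ### The error profile -/

theorem sum_rpow_le {r : ℝ} (hr : r < 0) (hr1 : r ≠ -1) {a b : ℕ} (ha : 1 ≤ a) (hab : a ≤ b) :
    ∑ m ∈ Finset.Ico (a + 1) (b + 1), (m : ℝ) ^ r ≤
      ((b : ℝ) ^ (r + 1) - (a : ℝ) ^ (r + 1)) / (r + 1) := by
  have ha' : (0 : ℝ) < a := by exact_mod_cast ha
  have h1 : AntitoneOn (fun x : ℝ => x ^ r) (Set.Icc (a : ℝ) (b : ℝ)) := fun x hx y hy hxy =>
    Real.rpow_le_rpow_of_nonpos (ha'.trans_le hx.1) hxy hr.le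
  have h2 := h1.sum_le_integral_Ico hab
  rw [integral_rpow] at h2
  · rw [← Finset.sum_Ico_add' (fun m : ℕ => (m : ℝ) ^ r) a b 1]
    exact h2
  · right
    refine ⟨hr1, ?_⟩
    rw [Set.uIcc_of_le (by exact_mod_cast hab)]
    exact fun h => absurd h.1 (not_le.2 ha')

theorem sum_rpow_tail_le {s : ℝ} (hs : 1 < s) {a b : ℕ} (ha : 1 ≤ a) :
    ∑ m ∈ Finset.Ico (a + 1) (b + 1), (m : ℝ) ^ (-s) ≤ (a : ℝ) ^ (1 - s) / (s - 1) := by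
  have ha' : (0 : ℝ) < a := by exact_mod_cast ha
  have hs' : 0 < s - 1 := by linarith
  rcases le_or_gt a b with hab | hab
  · refine (sum_rpow_le (by linarith) (by linarith) ha hab).trans ?_
    rw [show -s + 1 = -(s - 1) by ring, div_neg, ← neg_div, neg_sub,
      show 1 - s = -(s - 1) by ring]
    refine div_le_div_of_nonneg_right ?_ hs'.le
    have : 0 ≤ (b : ℝ) ^ (-(s - 1)) := by positivity
    linarith
  · rw [Finset.Ico_eq_empty (by omega), Finset.sum_empty]
    positivity

/-- The sum over distances that controls the error. -/
noncomputable def profileSum (s p : ℝ) (N : ℕ) : ℝ :=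
  ∑ m ∈ Finset.Icc 1 N, (m : ℝ) ^ (-s) * min 1 (p * m)

/-- The minimum switches branch at `m ≈ 1/p`: the linear branch is used up to `⌊1/p⌋`, the constant
one beyond. The floor is at least `1/(2p)` because `p ≤ 1`, hence the factor `2 ^ (s - 1)`. -/
theorem profileSum_le_split {s p : ℝ} (hs : 1 < s) (hp : 0 < p) (hp1 : p ≤ 2 / 3) (N : ℕ) :
    profileSum s p N ≤ p * ∑ m ∈ Finset.Icc 1 ⌊1 / p⌋₊, (m : ℝ) ^ (1 - s) +
      2 ^ (s - 1) * p ^ (s - 1) / (s - 1) := by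
  set n := ⌊1 / p⌋₊ with hn
  have hp2 : 1 ≤ 1 / p := by rw [le_div_iff₀ hp]; linarith
  have hn1 : 1 ≤ n := Nat.le_floor (by rw [Nat.cast_one]; exact hp2)
  have hn2 : 1 / (2 * p) ≤ n := by
    have h1 := Nat.lt_floor_add_one (1 / p)
    rw [← hn] at h1
    have h2 : (1 : ℝ) ≤ n := by exact_mod_cast hn1
    have h3 : 1 / (2 * p) = (1 / p) / 2 := by field_simp
    rw [h3]; linarith
  have htail : ∑ m ∈ Finset.Ico (n + 1) (N + 1), (m : ℝ) ^ (-s) ≤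
      2 ^ (s - 1) * p ^ (s - 1) / (s - 1) := by
    refine (sum_rpow_tail_le hs hn1).trans (div_le_div_of_nonneg_right ?_ (by linarith))
    calc (n : ℝ) ^ (1 - s) ≤ (1 / (2 * p)) ^ (1 - s) :=
          Real.rpow_le_rpow_of_nonpos (by positivity) hn2 (by linarith)
      _ = 2 ^ (s - 1) * p ^ (s - 1) := by
          rw [one_div, Real.inv_rpow (by positivity), ← Real.rpow_neg (by positivity), neg_sub,
            Real.mul_rpow (by norm_num) hp.le]
  refine le_trans ?_ (add_le_add_right htail _)
  have hsub : Finset.Icc 1 N ⊆ Finset.Icc 1 n ∪ Finset.Ico (n + 1) (N + 1) := by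
    intro m hm
    simp only [Finset.mem_union, Finset.mem_Icc, Finset.mem_Ico] at hm ⊢
    omega
  have hdisj : Disjoint (Finset.Icc 1 n) (Finset.Ico (n + 1) (N + 1)) := by
    rw [Finset.disjoint_left]
    intro m hm
    simp only [Finset.mem_Icc, Finset.mem_Ico] at hm ⊢
    omega
  refine (Finset.sum_le_sum_of_subset_of_nonneg hsub fun m _ _ => by positivity).trans ?_
  rw [Finset.sum_union hdisj, Finset.mul_sum]
  refine add_le_add (Finset.sum_le_sum fun m hm => ?_) (Finset.sum_le_sum fun m hm => ?_)
  · have hm0 : (0 : ℝ) < m := by exact_mod_cast (Finset.mem_Icc.1 hm).1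
    calc _ ≤ (m : ℝ) ^ (-s) * (p * m) :=
          mul_le_mul_of_nonneg_left (min_le_right _ _) (by positivity)
      _ = _ := by
          rw [show 1 - s = -s + 1 by ring, Real.rpow_add hm0, Real.rpow_one]; ring
  · calc _ ≤ (m : ℝ) ^ (-s) * 1 := mul_le_mul_of_nonneg_left (min_le_left _ _) (by positivity)
      _ = _ := mul_one _

theorem sum_Icc_eq_one_add {n : ℕ} (hn : 1 ≤ n) (r : ℝ) :
    ∑ m ∈ Finset.Icc 1 n, (m : ℝ) ^ r = 1 + ∑ m ∈ Finset.Ico (1 + 1) (n + 1), (m : ℝ) ^ r := by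
  rw [← Finset.Ico_add_one_right_eq_Icc, Finset.sum_eq_sum_Ico_succ_bot (by omega)]
  simp

theorem profileSum_zero (s : ℝ) (N : ℕ) : profileSum s 0 N = 0 := by
  simp [profileSum]

/-- Here `∑ m^(1-s)` up to `1/p` diverges like `p^(s-2)`, so both halves of the split are of order
`p^(s-1)`. -/
theorem profileSum_le_of_lt {s : ℝ} (hs : 1 < s) (hs2 : s < 2) : ∃ C : ℝ, 0 ≤ C ∧
    ∀ p, 0 ≤ p → p ≤ 2 / 3 → ∀ N, profileSum s p N ≤ C * p ^ (s - 1) := by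
  refine ⟨1 / (2 - s) + 2 ^ (s - 1) / (s - 1), ?_, fun p hp hp1 N => ?_⟩
  · have : 0 < 2 - s := by linarith
    have : 0 < s - 1 := by linarith
    positivity
  rcases hp.eq_or_lt with rfl | hp
  · rw [profileSum_zero, Real.zero_rpow (by linarith), mul_zero]
  refine (profileSum_le_split hs hp hp1 N).trans ?_
  have hp2 : 1 ≤ 1 / p := by rw [le_div_iff₀ hp]; linarith
  set n := ⌊1 / p⌋₊ with hn
  have hn1 : 1 ≤ n := Nat.le_floor (by rw [Nat.cast_one]; exact hp2)
  have hnp : (n : ℝ) ≤ 1 / p := Nat.floor_le (by positivity)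
  have h1 := sum_rpow_le (r := 1 - s) (by linarith) (by linarith) le_rfl hn1
  rw [show 1 - s + 1 = 2 - s by ring, Nat.cast_one, Real.one_rpow] at h1
  have hs3 : 0 < 2 - s := by linarith
  have h2 : ∑ m ∈ Finset.Icc 1 n, (m : ℝ) ^ (1 - s) ≤ p ^ (s - 2) / (2 - s) := by
    rw [sum_Icc_eq_one_add hn1]
    have h3 : (n : ℝ) ^ (2 - s) ≤ p ^ (s - 2) := by
      calc (n : ℝ) ^ (2 - s) ≤ (1 / p) ^ (2 - s) :=
            Real.rpow_le_rpow (by positivity) hnp hs3.le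
        _ = p ^ (s - 2) := by
            rw [one_div, Real.inv_rpow hp.le, ← Real.rpow_neg hp.le, neg_sub]
    have h4 : 1 ≤ 1 / (2 - s) := by rw [le_div_iff₀ hs3]; linarith
    have h5 := div_le_div_of_nonneg_right h3 hs3.le
    rw [sub_div] at h1
    linarith
  calc _ ≤ p * (p ^ (s - 2) / (2 - s)) + 2 ^ (s - 1) * p ^ (s - 1) / (s - 1) := by
        have := mul_le_mul_of_nonneg_left h2 hp.le
        linarith
    _ = _ := by
        rw [show s - 1 = (s - 2) + 1 by ring, Real.rpow_add hp (s - 2) 1, Real.rpow_one]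
        ring

/-- At the critical exponent the linear half is a harmonic sum, which produces the logarithm. -/
theorem profileSum_two_le : ∃ C : ℝ, 0 ≤ C ∧
    ∀ p, 0 ≤ p → p ≤ 2 / 3 → ∀ N, profileSum 2 p N ≤ C * (p + Real.negMulLog p) := by
  refine ⟨3, by norm_num, fun p hp hp1 N => ?_⟩
  rcases hp.eq_or_lt with rfl | hp
  · simp [profileSum_zero]
  refine (profileSum_le_split one_lt_two hp hp1 N).trans ?_
  have hp2 : 1 ≤ 1 / p := by rw [le_div_iff₀ hp]; linarith
  set n := ⌊1 / p⌋₊ with hn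
  have hn1 : 1 ≤ n := Nat.le_floor (by rw [Nat.cast_one]; exact hp2)
  have hnp : (n : ℝ) ≤ 1 / p := Nat.floor_le (by positivity)
  have h1 : ∑ m ∈ Finset.Icc 1 n, (m : ℝ) ^ ((1 : ℝ) - 2) ≤ 1 + Real.log (1 / p) := by
    have h2 := harmonic_le_one_add_log n
    rw [harmonic_eq_sum_Icc] at h2
    push_cast at h2
    have h3 : Real.log n ≤ Real.log (1 / p) :=
      Real.log_le_log (by exact_mod_cast hn1) hnp
    have h4 : ∑ m ∈ Finset.Icc 1 n, (m : ℝ) ^ ((1 : ℝ) - 2) = ∑ m ∈ Finset.Icc 1 n, (m : ℝ)⁻¹ :=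
      Finset.sum_congr rfl fun m _ => by
        rw [show (1 : ℝ) - 2 = -1 by norm_num, Real.rpow_neg_one]
    linarith
  rw [one_div, Real.log_inv] at h1
  have h5 := mul_le_mul_of_nonneg_left h1 hp.le
  have h6 : Real.log p ≤ 0 := Real.log_nonpos hp.le (by linarith)
  rw [Real.negMulLog]
  norm_num
  norm_num at h5
  nlinarith

/-- The linear branch alone is summable, so no split is needed. -/
theorem profileSum_le_of_gt {s : ℝ} (hs : 2 < s) : ∃ C : ℝ, 0 ≤ C ∧
    ∀ p, 0 ≤ p → p ≤ 2 / 3 → ∀ N, profileSum s p N ≤ C * p := by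
  have hsum : Summable fun m : ℕ => (m : ℝ) ^ (1 - s) := Real.summable_nat_rpow.2 (by linarith)
  refine ⟨∑' m : ℕ, (m : ℝ) ^ (1 - s), tsum_nonneg fun m => by positivity, fun p hp hp1 N => ?_⟩
  calc profileSum s p N ≤ ∑ m ∈ Finset.Icc 1 N, (m : ℝ) ^ (1 - s) * p := by
        refine Finset.sum_le_sum fun m hm => ?_
        have hm0 : (0 : ℝ) < m := by exact_mod_cast (Finset.mem_Icc.1 hm).1
        calc _ ≤ (m : ℝ) ^ (-s) * (p * m) :=
              mul_le_mul_of_nonneg_left (min_le_right _ _) (by positivity)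
          _ = _ := by
              rw [show 1 - s = -s + 1 by ring, Real.rpow_add hm0, Real.rpow_one]; ring
    _ ≤ _ := by
        rw [← Finset.sum_mul]
        exact mul_le_mul_of_nonneg_right (hsum.sum_le_tsum _ fun m _ => by positivity) hp

/-- A profile with the required asymptotics that dominates `p` and the sums over distances. -/
theorem exists_profile (D : ℕ) (μ : ℝ) (hμ : (D : ℝ) < μ) :
    ∃ f : ℝ → ℝ, ContinuousOn f (Set.Icc 0 (2 / 3)) ∧ Tendsto f (𝓝[>] 0) (𝓝 0) ∧
      (μ < D + 1 → f =O[𝓝[>] 0] fun p => p ^ (μ - D)) ∧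
      (μ = D + 1 → f =O[𝓝[>] 0] fun p => p * Real.log (1 / p)) ∧
      (D + 1 < μ → f =O[𝓝[>] 0] fun p => p) ∧
      (∀ p, 0 ≤ p → p ≤ 2 / 3 → p ≤ f p) ∧
      ∃ C : ℝ, 0 ≤ C ∧ ∀ p, 0 ≤ p → p ≤ 2 / 3 → ∀ N, profileSum (μ - D + 1) p N ≤ C * f p := by
  have hcts : ∀ f : ℝ → ℝ, Continuous f → f 0 = 0 → Tendsto f (𝓝[>] 0) (𝓝 0) := fun f hf h0 => by
    have := hf.tendsto 0
    rw [h0] at this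
    exact this.mono_left nhdsWithin_le_nhds
  rcases lt_trichotomy μ (D + 1) with h | h | h
  · have hf : Continuous fun p : ℝ => p ^ (μ - D) := Real.continuous_rpow_const (by linarith)
    refine ⟨fun p => p ^ (μ - D), hf.continuousOn, hcts _ hf (Real.zero_rpow (by linarith)),
      fun _ => isBigO_refl _ _, fun h' => absurd h' h.ne, fun h' => absurd h' h.not_gt, ?_, ?_⟩
    · intro p hp hp1
      rcases hp.eq_or_lt with rfl | hp
      · exact (Real.zero_rpow (by linarith)).ge
      · calc p = p ^ (1 : ℝ) := (Real.rpow_one p).symm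
          _ ≤ _ := Real.rpow_le_rpow_of_exponent_ge hp (by linarith) (by linarith)
    · obtain ⟨C, hC, hCp⟩ := profileSum_le_of_lt (s := μ - D + 1) (by linarith) (by linarith)
      exact ⟨C, hC, fun p hp hp1 N => by simpa using hCp p hp hp1 N⟩
  · have hf : Continuous fun p : ℝ => p + Real.negMulLog p :=
      continuous_id.add Real.continuous_negMulLog
    -- The summand `p` gives `p ≤ f p` at once and absorbs the constant term of the harmonic bound;
    -- near `0` it is dominated by `p * log (1/p)`.
    refine ⟨fun p => p + Real.negMulLog p, hf.continuousOn, hcts _ hf (by simp),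
      fun h' => absurd h h'.ne, fun _ => ?_, fun h' => absurd h h'.ne', ?_, ?_⟩
    · refine IsBigO.of_bound 2 ?_
      have h1 : ∀ᶠ p : ℝ in 𝓝[>] 0, p < Real.exp (-1) :=
        nhdsWithin_le_nhds (eventually_lt_nhds (Real.exp_pos _))
      filter_upwards [h1, self_mem_nhdsWithin] with p hp1 (hp : 0 < p)
      have h2 : Real.log p ≤ -1 := by
        rw [← Real.log_exp (-1)]; exact Real.log_le_log hp hp1.le
      have h3 : 1 ≤ Real.log (1 / p) := by rw [one_div, Real.log_inv]; linarith
      have h4 : p + Real.negMulLog p = p * (1 + Real.log (1 / p)) := by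
        rw [Real.negMulLog, one_div, Real.log_inv]; ring
      rw [h4, Real.norm_of_nonneg (mul_nonneg hp.le (by linarith)),
        Real.norm_of_nonneg (mul_nonneg hp.le (by linarith))]
      nlinarith
    · intro p hp hp1
      have := Real.negMulLog_nonneg hp (by linarith)
      linarith
    · have hs : μ - D + 1 = 2 := by linarith
      rw [hs]
      exact profileSum_two_le
  · refine ⟨fun p => p, continuousOn_id, hcts _ continuous_id rfl, fun h' => absurd h' h.not_gt,
      fun h' => absurd h' h.ne', fun _ => isBigO_refl _ _, fun p _ _ => le_rfl, ?_⟩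
    exact profileSum_le_of_gt (by linarith)

theorem exists_sum_rpow_bound {s : ℝ} (hs : 1 < s) : ∃ Z : ℝ, 0 ≤ Z ∧
    ∀ N : ℕ, ∑ m ∈ Finset.Icc 1 N, (m : ℝ) ^ (-s) ≤ Z := by
  have hsum : Summable fun m : ℕ => (m : ℝ) ^ (-s) := Real.summable_nat_rpow.2 (by linarith)
  exact ⟨_, tsum_nonneg fun m => by positivity,
    fun N => hsum.sum_le_tsum _ fun m _ => by positivity⟩

/-! ### Summation of the errors of the bilinears -/

/-- A bound, as a function of the distance `r`, on the error of a bilinear after `d` layers: a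
contribution of the short distances and one of the decaying correlations. -/
noncomputable def errorBound (D ℓ : ℕ) (a g q μ p : ℝ) (d r : ℕ) : ℝ :=
  (if r ≤ 4 * (d * ℓ) then a * p * (d : ℝ) ^ (D + 1) else 0) +
    (if 1 ≤ r then g * d * ((r : ℝ) ^ (-μ) * (min 1 (p * r) + p * q * (d : ℝ) ^ D)) else 0)

theorem sum_near_le {D L ℓ d : ℕ} (hd : 1 ≤ d) (r : Site D L) {x : ℝ} (hx : 0 ≤ x) :
    ∑ s : Site D L, (if siteDist r s ≤ 4 * (d * ℓ) then x else 0) ≤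
      (8 * ℓ + 1 : ℝ) ^ D * (d : ℝ) ^ D * x := by
  rw [← Finset.sum_filter, Finset.sum_const, nsmul_eq_mul]
  refine mul_le_mul_of_nonneg_right ?_ hx
  have h1 : (siteBall r (4 * (d * ℓ))).card ≤ (8 * ℓ + 1) ^ D * d ^ D := by
    refine (card_siteBall_le r _).trans ?_
    rw [← mul_pow]
    exact Nat.pow_le_pow_left (by nlinarith) _
  exact_mod_cast h1

/-- Shells of size `O(m^(D-1))` turn the decay exponent `μ` into `μ - D + 1`. The cutoff `N` depends
on the lattice, so all later bounds are uniform in it. -/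
theorem sum_decay_le {D L : ℕ} (hD : 1 ≤ D) (r : Site D L) {μ p y : ℝ} (hp : 0 ≤ p) (hy : 0 ≤ y) :
    ∃ N : ℕ, ∑ s : Site D L, (if 1 ≤ siteDist r s then
        (siteDist r s : ℝ) ^ (-μ) * (min 1 (p * siteDist r s) + y) else 0) ≤
      4 * 3 ^ (D - 1) * (profileSum (μ - D + 1) p N +
        y * ∑ m ∈ Finset.Icc 1 N, (m : ℝ) ^ (-(μ - D + 1))) := by
  obtain ⟨N, hN⟩ := sum_far_le hD r (fun m => (m : ℝ) ^ (-μ) * (min 1 (p * m) + y))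
    (fun m => by positivity)
  refine ⟨N, ?_⟩
  rw [← Finset.sum_filter]
  refine hN.trans ?_
  rw [profileSum, Finset.mul_sum, ← Finset.sum_add_distrib, Finset.mul_sum]
  refine Finset.sum_le_sum fun m hm => ?_
  have hm1 := (Finset.mem_Icc.1 hm).1
  have hm0 : (0 : ℝ) < m := by exact_mod_cast hm1
  have h1 : ((4 * (2 * m + 1) ^ (D - 1) : ℕ) : ℝ) ≤ 4 * 3 ^ (D - 1) * (m : ℝ) ^ (D - 1) := by
    rw [mul_assoc, ← mul_pow]
    have h2 : (2 * m + 1) ^ (D - 1) ≤ (3 * m) ^ (D - 1) := Nat.pow_le_pow_left (by omega) _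
    exact_mod_cast Nat.mul_le_mul_left 4 h2
  have h3 : (m : ℝ) ^ (-(μ - D + 1)) = (m : ℝ) ^ (D - 1) * (m : ℝ) ^ (-μ) := by
    rw [← Real.rpow_natCast, ← Real.rpow_add hm0]
    congr 1
    push_cast [Nat.cast_sub hD]
    ring
  calc _ ≤ 4 * 3 ^ (D - 1) * (m : ℝ) ^ (D - 1) * ((m : ℝ) ^ (-μ) * (min 1 (p * m) + y)) :=
        mul_le_mul_of_nonneg_right h1 (by positivity)
    _ = _ := by rw [h3]; ring

/-- The close sites number `O(d^D)` and cost `O(p d^(D+1))` each, which fixes the exponent `2D + 1`;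
the decaying part needs only `d^(D+1)`. Terms linear in `p` are absorbed by `p ≤ f p`. -/
theorem exists_sum_errorBound_le {D : ℕ} (hD : 1 ≤ D) (ℓ : ℕ) {a g q μ : ℝ} (ha : 0 ≤ a)
    (hg : 0 ≤ g) (hq : 0 ≤ q) (hμ : (D : ℝ) < μ) {f : ℝ → ℝ}
    (hfp : ∀ p, 0 ≤ p → p ≤ 2 / 3 → p ≤ f p)
    (hf : ∃ C : ℝ, 0 ≤ C ∧ ∀ p, 0 ≤ p → p ≤ 2 / 3 → ∀ N, profileSum (μ - D + 1) p N ≤ C * f p) :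
    ∃ C : ℝ, 0 < C ∧ ∀ (L : ℕ) (r : Site D L) (p : ℝ), 0 ≤ p → p ≤ 2 / 3 → ∀ d : ℕ, 1 ≤ d →
      ∑ b : Mode D L, errorBound D ℓ a g q μ p d (siteDist r b.1) ≤
        f p * (C * (d : ℝ) ^ (2 * D + 1)) := by
  obtain ⟨C₁, hC₁, hprof⟩ := hf
  obtain ⟨Z, hZ, hsum⟩ := exists_sum_rpow_bound (s := μ - D + 1) (by linarith)
  refine ⟨2 * ((8 * ℓ + 1) ^ D * a) + 2 * (g * (4 * 3 ^ (D - 1) * (C₁ + q * Z))) + 1,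
    by positivity, fun L r p hp hp1 d hd => ?_⟩
  have hd1 : (1 : ℝ) ≤ d := by exact_mod_cast hd
  have hf0 : 0 ≤ f p := hp.trans (hfp p hp hp1)
  rw [Fintype.sum_prod_type]
  simp only [Fin.sum_univ_two, ← two_mul]
  rw [← Finset.mul_sum]
  simp only [errorBound]
  rw [Finset.sum_add_distrib]
  have h1 := sum_near_le (ℓ := ℓ) hd r (x := a * p * (d : ℝ) ^ (D + 1)) (by positivity)
  obtain ⟨N, h2⟩ := sum_decay_le hD r (μ := μ) (p := p) (y := p * q * (d : ℝ) ^ D) hp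
    (by positivity)
  have h3 : ∑ s : Site D L, (if 1 ≤ siteDist r s then g * d * ((siteDist r s : ℝ) ^ (-μ) *
      (min 1 (p * siteDist r s) + p * q * (d : ℝ) ^ D)) else 0) =
      g * d * ∑ s : Site D L, (if 1 ≤ siteDist r s then ((siteDist r s : ℝ) ^ (-μ) *
      (min 1 (p * siteDist r s) + p * q * (d : ℝ) ^ D)) else 0) := by
    rw [Finset.mul_sum]
    exact Finset.sum_congr rfl fun s _ => by rw [mul_ite, mul_zero]
  have h4 : (8 * ℓ + 1 : ℝ) ^ D * (d : ℝ) ^ D * (a * p * (d : ℝ) ^ (D + 1)) ≤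
      f p * ((8 * ℓ + 1) ^ D * a * (d : ℝ) ^ (2 * D + 1)) := by
    have h5 : (8 * ℓ + 1 : ℝ) ^ D * (d : ℝ) ^ D * (a * p * (d : ℝ) ^ (D + 1)) =
        p * ((8 * ℓ + 1) ^ D * a * (d : ℝ) ^ (2 * D + 1)) := by ring
    rw [h5]
    exact mul_le_mul_of_nonneg_right (hfp p hp hp1) (by positivity)
  have h6 : profileSum (μ - D + 1) p N + p * q * (d : ℝ) ^ D *
      ∑ m ∈ Finset.Icc 1 N, (m : ℝ) ^ (-(μ - D + 1)) ≤ f p * ((C₁ + q * Z) * (d : ℝ) ^ (2 * D)) := by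
    have h7 : (1 : ℝ) ≤ (d : ℝ) ^ (2 * D) := one_le_pow₀ hd1
    have h8 : (d : ℝ) ^ D ≤ (d : ℝ) ^ (2 * D) := pow_le_pow_right₀ hd1 (by omega)
    have h9 : profileSum (μ - D + 1) p N ≤ f p * (C₁ * (d : ℝ) ^ (2 * D)) := by
      calc _ ≤ C₁ * f p * 1 := by rw [mul_one]; exact hprof p hp hp1 N
        _ ≤ C₁ * f p * (d : ℝ) ^ (2 * D) := mul_le_mul_of_nonneg_left h7 (by positivity)
        _ = _ := by ring
    have h10 : p * q * (d : ℝ) ^ D * ∑ m ∈ Finset.Icc 1 N, (m : ℝ) ^ (-(μ - D + 1)) ≤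
        f p * (q * Z * (d : ℝ) ^ (2 * D)) := by
      calc _ ≤ f p * q * (d : ℝ) ^ (2 * D) * Z := by
            refine mul_le_mul ?_ (hsum N) (Finset.sum_nonneg fun m _ => by positivity)
              (by positivity)
            exact mul_le_mul (mul_le_mul_of_nonneg_right (hfp p hp hp1) hq) h8 (by positivity)
              (by positivity)
        _ = _ := by ring
    linarith
  calc _ ≤ (2 : ℝ) * (f p * ((8 * ℓ + 1) ^ D * a * (d : ℝ) ^ (2 * D + 1)) + g * d *
        (4 * 3 ^ (D - 1) * (f p * ((C₁ + q * Z) * (d : ℝ) ^ (2 * D))))) := by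
        refine mul_le_mul_of_nonneg_left (add_le_add (h1.trans h4) ?_) (by positivity)
        rw [h3]
        refine mul_le_mul_of_nonneg_left (h2.trans ?_) (by positivity)
        exact mul_le_mul_of_nonneg_left h6 (by positivity)
    _ = f p * ((2 * ((8 * ℓ + 1) ^ D * a) + 2 * (g * (4 * 3 ^ (D - 1) * (C₁ + q * Z)))) *
        (d : ℝ) ^ (2 * D + 1)) := by ring
    _ ≤ _ := by
        refine mul_le_mul_of_nonneg_left ?_ hf0
        exact mul_le_mul_of_nonneg_right (by linarith) (by positivity)

theorem errorBound_nonneg {D ℓ : ℕ} {a g q μ p : ℝ} (ha : 0 ≤ a) (hg : 0 ≤ g) (hq : 0 ≤ q)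
    (hp : 0 ≤ p) (d r : ℕ) : 0 ≤ errorBound D ℓ a g q μ p d r := by
  unfold errorBound
  split_ifs <;> positivity

/-! ### The bound for one bilinear, and the observable as a sum of bilinears -/

section Circuit

variable {D L n φ₀ ℓ : ℕ} {E : LocalEncoding D L n φ₀} {p αx αy αz : ℝ}

theorem norm_pairError_le_errorBound (hD : 1 ≤ D) (hp : NoiseParams p αx αy αz)
    {ρ : FermionOp D L} (hρ : IsState ρ) (hs : E.sector * ρ = ρ) {K μ : ℝ} (hK : 0 ≤ K)
    (hμ : 0 ≤ μ) (hcl : Clusters ρ K μ) {c : List (Layer E ℓ)} (hc : 1 ≤ c.length) {a b : Mode D L}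
    (hab : a ≠ b) {q : ℕ} (hq : q = 8 * (2 * ℓ + 1) ^ (2 * D) * (φ₀ + ℓ)) :
    ‖pairError E c p αx αy αz ρ a b‖ ≤ errorBound D ℓ (2 * (φ₀ + 4 * ℓ + q)) (2 * (2 ^ μ * K))
      (φ₀ + q) μ p c.length (siteDist a.1 b.1) := by
  have hp0 := hp.p_nonneg
  set r := siteDist a.1 b.1 with hr
  set d := c.length with hd
  have hd1 : (1 : ℝ) ≤ d := by exact_mod_cast hc
  have hdD : (1 : ℝ) ≤ (d : ℝ) ^ D := one_le_pow₀ hd1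
  unfold errorBound
  rcases le_or_gt r (4 * (d * ℓ)) with h | h
  · have h1 := norm_pairError_le hp hρ hs hc hab
    rw [← hq] at h1
    refine h1.trans ?_
    rw [if_pos h]
    have h2 : (d : ℝ) ≤ (d : ℝ) ^ D := le_self_pow₀ hd1 (by omega)
    have h3 : (r : ℝ) ≤ 4 * ℓ * (d : ℝ) ^ D := by
      have h4 : (r : ℝ) ≤ 4 * (d * ℓ) := by exact_mod_cast h
      have h5 := mul_le_mul_of_nonneg_right h2 (Nat.cast_nonneg (α := ℝ) ℓ)
      linarith
    have h4 : (φ₀ + r + q * (d : ℝ) ^ D : ℝ) ≤ (φ₀ + 4 * ℓ + q) * (d : ℝ) ^ D := by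
      have h5 := mul_le_mul_of_nonneg_left hdD (Nat.cast_nonneg (α := ℝ) φ₀)
      linarith
    have h6 : (2 : ℝ) * 1 * min 1 (d * (p * (φ₀ + r + q * (d : ℝ) ^ D))) ≤
        2 * (φ₀ + 4 * ℓ + q) * p * (d : ℝ) ^ (D + 1) := by
      calc _ ≤ (2 : ℝ) * 1 * (d * (p * ((φ₀ + 4 * ℓ + q) * (d : ℝ) ^ D))) := by
            refine mul_le_mul_of_nonneg_left ((min_le_right _ _).trans ?_) (by norm_num)
            exact mul_le_mul_of_nonneg_left (mul_le_mul_of_nonneg_left h4 hp0) (by positivity)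
        _ = _ := by ring
    refine h6.trans (le_add_of_nonneg_right ?_)
    split_ifs <;> positivity
  · have h1 := norm_pairError_far_le hp hρ hs hK hμ hcl hc h
    rw [← hq] at h1
    refine h1.trans ?_
    rw [if_neg (by omega), if_pos (by omega), zero_add]
    -- The part of the error proportional to `r` must stay capped by `1`, since `r^(1-μ)` need not
    -- be summable over the lattice; the rest may be linear in `p`. The factor `d ≥ 1` is pulled out
    -- of the minimum.
    have h2 : min 1 ((d : ℝ) * (p * (φ₀ + r + q * (d : ℝ) ^ D))) ≤
        d * (min 1 (p * r) + p * (φ₀ + q) * (d : ℝ) ^ D) := by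
      have h3 : (φ₀ + q * (d : ℝ) ^ D : ℝ) ≤ (φ₀ + q) * (d : ℝ) ^ D := by
        have h5 := mul_le_mul_of_nonneg_left hdD (Nat.cast_nonneg (α := ℝ) φ₀)
        linarith
      have h4 := mul_le_mul_of_nonneg_left h3 hp0
      rcases le_total 1 (p * r) with h5 | h5
      · rw [min_eq_left h5]
        refine (min_le_left _ _).trans ?_
        have h6 : 0 ≤ p * (φ₀ + q) * (d : ℝ) ^ D := by positivity
        nlinarith
      · rw [min_eq_right h5]
        refine (min_le_right _ _).trans (mul_le_mul_of_nonneg_left ?_ (by positivity))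
        linarith
    calc _ ≤ 2 * (2 ^ μ * K * (r : ℝ) ^ (-μ)) *
          (d * (min 1 (p * r) + p * (φ₀ + q) * (d : ℝ) ^ D)) :=
          mul_le_mul_of_nonneg_left h2 (by positivity)
      _ = _ := by ring

theorem coeff_diag_eq_zero {o : Matrix (Mode D L) (Mode D L) ℝ} (ho : IsQuadraticCoeff o)
    (a : Mode D L) : o a a = 0 := by
  have := congrFun (congrFun ho.1 a) a
  simp only [Matrix.transpose_apply, Matrix.neg_apply] at this
  linarith

/-- Antisymmetry removes the diagonal, where the string `bilinear a a` is not tied to `γ_a γ_a`. -/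
theorem measurementError_eq {ρ : FermionOp D L} (hs : ρ * E.sector = ρ) (c : List (Layer E ℓ))
    {o : Matrix (Mode D L) (Mode D L) ℝ} (ho : IsQuadraticCoeff o) :
    measurementError c p αx αy αz ρ o =
      ‖∑ a, ∑ b, (o a b : ℂ) * (if a = b then 0 else pairError E c p αx αy αz ρ a b)‖ := by
  have h1 : (quadratic o * idealState c ρ).trace = Complex.I * ∑ a, ∑ b, (o a b : ℂ) *
      (majorana a * majorana b * idealState c ρ).trace := by
    simp only [quadratic, Matrix.smul_mul, Finset.sum_mul, Matrix.trace_smul, Matrix.trace_sum,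
      smul_eq_mul]
  have h2 : (E.quadratic o * noisyState c p αx αy αz ρ).trace = Complex.I * ∑ a, ∑ b,
      (o a b : ℂ) * (E.bilinear a b * noisyState c p αx αy αz ρ).trace := by
    simp only [LocalEncoding.quadratic, Matrix.smul_mul, Finset.sum_mul, Matrix.trace_smul,
      Matrix.trace_sum, smul_eq_mul]
  rw [measurementError, h1, h2, ← mul_sub, norm_mul, Complex.norm_I, one_mul, norm_sub_rev]
  simp only [← Finset.sum_sub_distrib, ← mul_sub]
  congr 1
  refine Finset.sum_congr rfl fun a _ => Finset.sum_congr rfl fun b _ => ?_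
  split_ifs with h
  · rw [h, coeff_diag_eq_zero ho]; simp
  · rw [pairError, trace_noisyState, trace_idealState c hs (E.bilinear_mul_V h)]

theorem measurementError_nil {ρ : FermionOp D L} (hs : ρ * E.sector = ρ)
    {o : Matrix (Mode D L) (Mode D L) ℝ} (ho : IsQuadraticCoeff o) :
    measurementError ([] : List (Layer E ℓ)) p αx αy αz ρ o = 0 := by
  rw [measurementError_eq hs _ ho]
  simp [pairError, noisyObs, idealObs]

end Circuit

end FermionNoise

/-! ### Assembly of the estimate -/

theorem proposition3 (D : ℕ) (hD : 1 ≤ D) (μ : ℝ) (hμ : (D : ℝ) < μ) (K : ℝ) (hK : 0 ≤ K)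
    (φ₀ ℓ : ℕ) :
    ∃ f : ℝ → ℝ,
      ContinuousOn f (Set.Icc 0 (2 / 3)) ∧
      Tendsto f (𝓝[>] 0) (𝓝 0) ∧
      (μ < D + 1 → f =O[𝓝[>] 0] fun p => p ^ (μ - D)) ∧
      (μ = D + 1 → f =O[𝓝[>] 0] fun p => p * Real.log (1 / p)) ∧
      (D + 1 < μ → f =O[𝓝[>] 0] fun p => p) ∧
      ∃ C : ℝ, 0 < C ∧
        ∀ (L n : ℕ) (E : LocalEncoding D L n φ₀) (p αx αy αz : ℝ),
          0 ≤ p → p ≤ 2 / 3 → 0 ≤ αx → 0 ≤ αy → 0 ≤ αz → αx + αy + αz = 1 →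
          ∀ ρ₀ : FermionOp D L, IsState ρ₀ → E.sector * ρ₀ = ρ₀ → Clusters ρ₀ K μ →
          ∀ (c : List (Layer E ℓ)) (o : Matrix (Mode D L) (Mode D L) ℝ), IsQuadraticCoeff o →
            measurementError c p αx αy αz ρ₀ o ≤ f p * (C * (c.length : ℝ) ^ (2 * D + 1)) := by
  obtain ⟨f, hf1, hf2, hf3, hf4, hf5, hfp, hf⟩ := exists_profile D μ hμ
  set q : ℕ := 8 * (2 * ℓ + 1) ^ (2 * D) * (φ₀ + ℓ) with hq
  have hμ0 : 0 ≤ μ := (Nat.cast_nonneg D).trans hμ.le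
  obtain ⟨C, hC, hsum⟩ := exists_sum_errorBound_le hD ℓ (a := 2 * (φ₀ + 4 * ℓ + q))
    (g := 2 * (2 ^ μ * K)) (q := φ₀ + q) (by positivity) (by positivity) (by positivity) hμ hfp hf
  refine ⟨f, hf1, hf2, hf3, hf4, hf5, C, hC, ?_⟩
  intro L n E p αx αy αz hp hp1 hx hy hz hα ρ hρ hs hcl c o ho
  have hs' := sector_mul_of_isState hρ hs
  have hf0 : 0 ≤ f p := hp.trans (hfp p hp hp1)
  -- For depth zero the right-hand side vanishes, so the error must be exactly zero; the estimates
  -- above require `1 ≤ d`.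
  rcases Nat.eq_zero_or_pos c.length with hc | hc
  · rw [List.length_eq_zero_iff.1 hc, measurementError_nil hs' ho]
    positivity
  have hN : NoiseParams p αx αy αz := ⟨hp, hp1, hx, hy, hz, hα⟩
  have hrow : ∀ a : Mode D L, ∑ b : Mode D L, errorBound D ℓ (2 * (φ₀ + 4 * ℓ + q))
      (2 * (2 ^ μ * K)) (φ₀ + q) μ p c.length (siteDist a.1 b.1) ≤
      f p * (C * (c.length : ℝ) ^ (2 * D + 1)) := fun a => hsum L a.1 p hp hp1 c.length hc
  have hT : 0 ≤ f p * (C * (c.length : ℝ) ^ (2 * D + 1)) := by positivity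
  rw [measurementError_eq hs' c ho]
  refine (norm_sum_mul_le_traceNorm o _ (fun a b => errorBound D ℓ (2 * (φ₀ + 4 * ℓ + q))
    (2 * (2 ^ μ * K)) (φ₀ + q) μ p c.length (siteDist a.1 b.1)) _ ?_ hrow ?_ hT).trans ?_
  · intro a b
    split_ifs with h
    · rw [norm_zero]
      exact errorBound_nonneg (by positivity) (by positivity) (by positivity) hp _ _
    · exact norm_pairError_le_errorBound hD hN hρ hs hK hμ0 hcl hc h hq
  -- The bound depends only on the distance, so column sums are row sums.
  · intro b
    simp only [siteDist_comm _ b.1]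
    exact hrow b
  · exact mul_le_of_le_one_left hT ho.2
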